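/- Let $G$ be a finite simple (undirected, loopless, unweighted) graph with vertex set $V$, and let $k\ge 0$ be an integer. A word $x=x_1\cdots x_n\in V^n$ is a \emph{path} if $x_i$ and $x_{i+1}$ are adjacent in $G$ for $1\le i<n$. For $x\in V^n$ let $B(x)$ be the number of permutations $\sigma\in S_n$ such that, if the symbols of $x$ are inserted in the order $x_{\sigma(1)},x_{\sigma(2)},\dots,x_{\sigma(n)}$, each at its place relative to the symbols already present, then the word present at each time $t=1,\dots,n$ is a path. Equivalently, whenever a symbol is inserted it is adjacent in $G$ to its current left neighbour and to its current right neighbour, where these exist. The insertion algorithm on $G$ produces the distributions \[ \mathbb P_n(x)=\frac{B(x)}{\sum_{y\in V^n}B(y)},\qquad x\in V^n,\ n\ge 0 . \] We say that it \emph{yields a consistent family of distributions} if $\sum_{y\in V^n}B(y)>0$ for all $n$ and \[ \mathbb P_n(x)=\sum_{v\in V}\mathbb P_{n+1}(xv)=\sum_{v\in V}\mathbb P_{n+1}(vx)\qquad\text{for all } n \text{ and } x\in V^n, \] and in that case the \emph{insertion process} is the process $(X_i)_{i\in\mathbb Z}$ with values in $V$ and marginals $\mathbb P\bigl((X_{i+1},\dots,X_{i+n})=x\bigr)=\mathbb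 P_n(x)$ for all $i\in\mathbb Z$, $n\ge 0$ and $x\in V^n$. A stationary process $(X_i)_{i\in\mathbb Z}$ is \emph{$k$-dependent} if $(X_i)_{i<0}$ and $(X_i)_{i\ge k}$ are independent. Then the insertion algorithm on $G$ yields a consistent family of distributions and a stationary $k$-dependent insertion process if and only if one of the following holds: \begin{enumerate} \item $G$ is isomorphic to the complete multipartite graph $K_{r,r,r}$ (three parts of size $r$) for some $r\ge 1$, and $k\ge 2$; \item $G$ is isomorphic to the complete multipartite graph $K_{r,r,r,r}$ (four parts of size $r$) for some $r\ge 1$, and $k\ge 1$. \end{enumerate} -/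

import Mathlib

open MeasureTheory ProbabilityTheory

noncomputable section

namespace InsertionProcess

/-- In the building `σ` the symbol at position `σ t` arrives at time `t`. These are the positions
to the left of `σ t` that are occupied before time `t`. -/
def leftPositions {n : ℕ} (σ : Equiv.Perm (Fin n)) (t : Fin n) : Finset (Fin n) :=
  Finset.univ.filter fun p => σ.symm p < t ∧ p < σ t

/-- The positions to the right of `σ t` that are occupied before time `t`. -/
def rightPositions {n : ℕ} (σ : Equiv.Perm (Fin n)) (t : Fin n) : Finset (Fin n) :=
  Finset.univ.filter fun p => σ.symm p < t ∧ σ t < p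

/-- The weight of the building `(x, σ)` for the edge weights `w`: when the symbol `x (σ t)` is
inserted, it contributes the weight of the edge from its left neighbour at that time (if there is
one) and the weight of the edge to its right neighbour at that time (if there is one). -/
def buildingWeight {V : Type*} (w : V → V → ℝ) {n : ℕ} (x : Fin n → V)
    (σ : Equiv.Perm (Fin n)) : ℝ :=
  ∏ t : Fin n,
    ((if h : (leftPositions σ t).Nonempty
        then w (x ((leftPositions σ t).max' h)) (x (σ t)) else 1) *
     (if h : (rightPositions σ t).Nonempty
        then w (x (σ t)) (x ((rightPositions σ t).min' h)) else 1))

/-- The weighted building count of a word. -/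
def weightedBuildingCount {V : Type*} (w : V → V → ℝ) {n : ℕ} (x : Fin n → V) : ℝ :=
  ∑ σ : Equiv.Perm (Fin n), buildingWeight w x σ

open Classical in
/-- An unweighted graph as a weighted graph: edges have weight one, non-edges weight zero. -/
def unitWeight {V : Type*} (G : SimpleGraph V) (a b : V) : ℝ :=
  if G.Adj a b then 1 else 0

/-- The building count `B(x)` of a word `x` for an unweighted graph: the number of orders in which
the symbols of `x` can be inserted so that the word is a path of `G` at every time. -/
def buildingCount {V : Type*} (G : SimpleGraph V) {n : ℕ} (x : Fin n → V) : ℝ :=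
  weightedBuildingCount (unitWeight G) x

/-- The total `∑ B(y)` over all words `y` of length `n`. -/
def totalCount {V : Type*} [Fintype V] (G : SimpleGraph V) (n : ℕ) : ℝ :=
  ∑ y : Fin n → V, buildingCount G y

/-- The probability `P_n(x)` that the insertion algorithm assigns to the word `x`. -/
def wordProb {V : Type*} [Fintype V] (G : SimpleGraph V) {n : ℕ} (x : Fin n → V) : ℝ :=
  buildingCount G x / totalCount G n

/-- The insertion algorithm yields a consistent family of distributions: every `P_n` is a
probability distribution (the normalizing total does not vanish), and deleting the last or the
first symbol of a `P_{n+1}`-distributed word gives a `P_n`-distributed word. -/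
def IsConsistent {V : Type*} [Fintype V] (G : SimpleGraph V) : Prop :=
  (∀ n : ℕ, 0 < totalCount G n) ∧
  ∀ (n : ℕ) (x : Fin n → V),
    wordProb G x = ∑ v : V, wordProb G (Fin.snoc x v : Fin (n + 1) → V) ∧
    wordProb G x = ∑ v : V, wordProb G (Fin.cons v x : Fin (n + 1) → V)

/-- `μ` is the law of the insertion process of `G`: the probability measure on bi-infinite
sequences all of whose windows of length `n` have law `P_n`. -/
def IsInsertionLaw {V : Type*} [Fintype V] [MeasurableSpace V] (G : SimpleGraph V)
    (μ : Measure (ℤ → V)) : Prop :=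
  IsProbabilityMeasure μ ∧
  ∀ (i : ℤ) (n : ℕ) (x : Fin n → V),
    μ {ω | ∀ j : Fin n, ω (i + 1 + (j : ℕ)) = x j} = ENNReal.ofReal (wordProb G x)

/-- The coordinate process is stationary under `μ`. -/
def IsStationary {V : Type*} [MeasurableSpace V] (μ : Measure (ℤ → V)) : Prop :=
  μ.map (fun (ω : ℤ → V) (i : ℤ) => ω (i + 1)) = μ

/-- Under `μ` the coordinates `(X_i)_{i < 0}` and `(X_i)_{i ≥ k}` are independent. -/
def IsKDependent {V : Type*} [MeasurableSpace V] (k : ℕ) (μ : Measure (ℤ → V)) : Prop :=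
  IndepFun (fun (ω : ℤ → V) (i : {i : ℤ // i < 0}) => ω i)
    (fun (ω : ℤ → V) (i : {i : ℤ // (k : ℤ) ≤ i}) => ω i) μ

end InsertionProcess

end

/-! ### The deletion recursion for building counts -/

open MeasureTheory ProbabilityTheory

noncomputable section

namespace InsertionProcess

variable {V : Type*}

/-! Everything rests on one recursion. Looking at the symbol inserted last, `B(x)` is the sum of `B`
over the words obtained by deleting one symbol if `x` is a nonempty path, and is zero if `x` is not
a path (`listCount_eq_delSum`, `listCount_eq_zero`).

Sufficiency. In a complete multipartite graph with `m` parts of size `r`, vertices of one part are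
interchangeable, so the recursion can be summed over an unspecified letter. At an end of the word
this multiplies `B` by a constant depending only on the length (`sum_listCount_append_singleton`),
which is consistency. For a gap of `k` free letters between `x` and `y` it gives the deletion
recursion plus a term proportional to the sum over a gap of length `k - 1`. Its coefficient is `(m -
4) r` for `k = 1` and `(2m - 6) r` for `k = 2` (`gapSum_one`, `gapSum_succ_succ`). When it vanishes,
induction on the lengths shows that the gap sum is `B(x) B(y)` times a function of the two lengths
(`exists_gapSum_eq_mul`). This is `k`-dependence on cylinders; a compactness argument supplies the
measure.

Necessity. Consistency on words of length one and two makes the graph regular of degree `d` and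
gives every edge the same number `lam` of common neighbours. With `A` the adjacency matrix and `N_n`
the matrix of two-point gap sums, `N_0 = 2A` and `N_{n+1} = (n+1) lam N_n + A N_n + N_n A`
(`gapSum_succ_singleton`). Dependence range `k` makes `N_k` constant, so every eigenvalue `θ` of `A`
on vectors of sum zero satisfies `j lam + 2θ = 0` for some `j ≤ k`. Hence `A` is negative
semidefinite there, which forces a complete multipartite graph, with equal parts by regularity. Then
`θ = -r` and `lam = (m - 2) r` give `j (m - 2) = 2`, leaving only `m = 4`, `j = 1` and `m = 3`, `j =
2`. -/

/-- The permutation which inserts the position `i` last, after the order `τ` of the others. -/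
def insertLast {n : ℕ} (i : Fin (n + 1)) (τ : Equiv.Perm (Fin n)) : Equiv.Perm (Fin (n + 1)) :=
  finSuccEquivLast.trans ((Equiv.optionCongr τ).trans (finSuccEquiv' i).symm)

@[simp] lemma insertLast_last {n : ℕ} (i : Fin (n + 1)) (τ : Equiv.Perm (Fin n)) :
    insertLast i τ (Fin.last n) = i := by
  simp [insertLast]

@[simp] lemma insertLast_castSucc {n : ℕ} (i : Fin (n + 1)) (τ : Equiv.Perm (Fin n)) (t : Fin n) :
    insertLast i τ t.castSucc = i.succAbove (τ t) := by
  simp [insertLast]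

@[simp] lemma insertLast_symm_self {n : ℕ} (i : Fin (n + 1)) (τ : Equiv.Perm (Fin n)) :
    (insertLast i τ).symm i = Fin.last n := by
  rw [Equiv.symm_apply_eq, insertLast_last]

@[simp] lemma insertLast_symm_succAbove {n : ℕ} (i : Fin (n + 1)) (τ : Equiv.Perm (Fin n))
    (p : Fin n) : (insertLast i τ).symm (i.succAbove p) = (τ.symm p).castSucc := by
  rw [Equiv.symm_apply_eq, insertLast_castSucc, Equiv.apply_symm_apply]

lemma insertLast_bijective (n : ℕ) :
    Function.Bijective fun q : Fin (n + 1) × Equiv.Perm (Fin n) => insertLast q.1 q.2 := by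
  rw [Fintype.bijective_iff_injective_and_card]
  refine ⟨?_, by simp [Fintype.card_perm, Nat.factorial_succ]⟩
  rintro ⟨i, τ⟩ ⟨j, ρ⟩ h
  have h' : insertLast i τ = insertLast j ρ := h
  have hij : i = j := by
    have := congrArg (fun σ : Equiv.Perm (Fin (n + 1)) => σ (Fin.last n)) h'
    simpa using this
  subst hij
  have hτ : τ = ρ := by
    ext1 t
    have := congrArg (fun σ : Equiv.Perm (Fin (n + 1)) => σ t.castSucc) h'
    simpa using this
  rw [hτ]

/-- The weight of inserting the symbol at `i` after all the others. -/
def insertionWeight (w : V → V → ℝ) {n : ℕ} (x : Fin (n + 1) → V) (i : Fin (n + 1)) : ℝ :=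
  (if _ : 0 < (i : ℕ) then w (x ⟨i - 1, by omega⟩) (x i) else 1) *
    (if _ : (i : ℕ) < n then w (x i) (x ⟨i + 1, by omega⟩) else 1)

lemma leftPositions_insertLast_castSucc {n : ℕ} (i : Fin (n + 1)) (τ : Equiv.Perm (Fin n))
    (t : Fin n) :
    leftPositions (insertLast i τ) t.castSucc = (leftPositions τ t).image i.succAbove := by
  ext p
  rcases Fin.eq_self_or_eq_succAbove i p with rfl | ⟨q, rfl⟩
  · simp [leftPositions, Fin.succAbove_ne, Fin.le_last]
  · simp [leftPositions]

lemma rightPositions_insertLast_castSucc {n : ℕ} (i : Fin (n + 1)) (τ : Equiv.Perm (Fin n))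
    (t : Fin n) :
    rightPositions (insertLast i τ) t.castSucc = (rightPositions τ t).image i.succAbove := by
  ext p
  rcases Fin.eq_self_or_eq_succAbove i p with rfl | ⟨q, rfl⟩
  · simp [rightPositions, Fin.succAbove_ne, Fin.le_last]
  · simp [rightPositions]

lemma leftPositions_insertLast_last {n : ℕ} (i : Fin (n + 1)) (τ : Equiv.Perm (Fin n)) :
    leftPositions (insertLast i τ) (Fin.last n) = Finset.Iio i := by
  ext p
  rcases Fin.eq_self_or_eq_succAbove i p with rfl | ⟨q, rfl⟩
  · simp [leftPositions]
  · simp [leftPositions, Fin.castSucc_lt_last]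

lemma rightPositions_insertLast_last {n : ℕ} (i : Fin (n + 1)) (τ : Equiv.Perm (Fin n)) :
    rightPositions (insertLast i τ) (Fin.last n) = Finset.Ioi i := by
  ext p
  rcases Fin.eq_self_or_eq_succAbove i p with rfl | ⟨q, rfl⟩
  · simp [rightPositions]
  · simp [rightPositions, Fin.castSucc_lt_last]

/-- The symbol at `i` arrives after all others, so the earlier steps do not see it. Since
`i.succAbove` is monotone it carries nearest occupied neighbours to nearest occupied neighbours. -/
lemma buildingWeight_insertLast (w : V → V → ℝ) {n : ℕ} (x : Fin (n + 1) → V)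
    (i : Fin (n + 1)) (τ : Equiv.Perm (Fin n)) :
    buildingWeight w x (insertLast i τ) =
      insertionWeight w x i * buildingWeight w (x ∘ i.succAbove) τ := by
  have hmono : Monotone i.succAbove := (Fin.strictMono_succAbove i).monotone
  rw [buildingWeight, Fin.prod_univ_castSucc, mul_comm]
  congr 1
  · simp only [leftPositions_insertLast_last, rightPositions_insertLast_last, insertLast_last,
      insertionWeight]
    congr 1
    · by_cases h : 0 < (i : ℕ)
      · have hne : (Finset.Iio i).Nonempty := ⟨⟨i - 1, by omega⟩, by
          rw [Finset.mem_Iio, Fin.lt_def]; simp only; omega⟩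
        have hm : (Finset.Iio i).max' hne = ⟨i - 1, by omega⟩ := by
          rw [Finset.max'_eq_iff]
          simp only [Finset.mem_Iio, Fin.lt_def, Fin.le_def]
          exact ⟨by omega, fun b hb => by omega⟩
        rw [dif_pos hne, dif_pos h, hm]
      · rw [dif_neg h, dif_neg]
        rintro ⟨p, hp⟩
        rw [Finset.mem_Iio, Fin.lt_def] at hp
        omega
    · by_cases h : (i : ℕ) < n
      · have hne : (Finset.Ioi i).Nonempty := ⟨⟨i + 1, by omega⟩, by
          rw [Finset.mem_Ioi, Fin.lt_def]; simp only; omega⟩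
        have hm : (Finset.Ioi i).min' hne = ⟨i + 1, by omega⟩ := by
          rw [Finset.min'_eq_iff]
          simp only [Finset.mem_Ioi, Fin.lt_def, Fin.le_def]
          exact ⟨by omega, fun b hb => by omega⟩
        rw [dif_pos hne, dif_pos h, hm]
      · rw [dif_neg h, dif_neg]
        rintro ⟨p, hp⟩
        rw [Finset.mem_Ioi, Fin.lt_def] at hp
        omega
  · rw [buildingWeight]
    refine Finset.prod_congr rfl fun t _ => ?_
    simp only [leftPositions_insertLast_castSucc, rightPositions_insertLast_castSucc,
      insertLast_castSucc, Finset.image_nonempty, Finset.max'_image hmono, Finset.min'_image hmono,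
      Function.comp_apply]

lemma weightedBuildingCount_succ (w : V → V → ℝ) {n : ℕ} (x : Fin (n + 1) → V) :
    weightedBuildingCount w x =
      ∑ i, insertionWeight w x i * weightedBuildingCount w (x ∘ i.succAbove) := by
  rw [weightedBuildingCount, ← (insertLast_bijective n).sum_comp, Fintype.sum_prod_type]
  refine Finset.sum_congr rfl fun i _ => ?_
  simp only [buildingWeight_insertLast, weightedBuildingCount, Finset.mul_sum]

/-- Consecutive symbols of the word `x` are adjacent. -/
def IsPathWord (G : SimpleGraph V) {n : ℕ} (x : Fin n → V) : Prop :=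
  ∀ (j : ℕ) (h : j + 1 < n), G.Adj (x ⟨j, by omega⟩) (x ⟨j + 1, h⟩)

lemma isPathWord_iff_isChain (G : SimpleGraph V) {n : ℕ} (x : Fin n → V) :
    IsPathWord G x ↔ (List.ofFn x).IsChain G.Adj := by
  rw [List.isChain_iff_getElem]
  simp [IsPathWord]

lemma insertionWeight_of_isPathWord (G : SimpleGraph V) {n : ℕ} {x : Fin (n + 1) → V}
    (hx : IsPathWord G x) (i : Fin (n + 1)) : insertionWeight (unitWeight G) x i = 1 := by
  have h1 : ∀ h : 0 < (i : ℕ), G.Adj (x ⟨i - 1, by omega⟩) (x i) := fun h => by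
    have := hx (i - 1) (by omega)
    have he : (⟨i - 1 + 1, by omega⟩ : Fin (n + 1)) = i := Fin.ext (by simp; omega)
    rwa [he] at this
  have h2 : ∀ h : (i : ℕ) < n, G.Adj (x i) (x ⟨i + 1, by omega⟩) := fun h => hx i (by omega)
  unfold insertionWeight unitWeight
  split_ifs <;> simp_all

/-- A consecutive pair avoiding `i` stays consecutive after the deletion of `i`; a pair containing
`i` is an edge tested by the insertion weight. -/
lemma isPathWord_of_insertionWeight_ne_zero (G : SimpleGraph V) {n : ℕ} {x : Fin (n + 1) → V}
    {i : Fin (n + 1)} (hi : insertionWeight (unitWeight G) x i ≠ 0)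
    (hx : IsPathWord G (x ∘ i.succAbove)) : IsPathWord G x := by
  intro j hj
  rw [insertionWeight, mul_ne_zero_iff] at hi
  rcases lt_trichotomy (j + 1) (i : ℕ) with h | h | h
  · have := hx j (by omega)
    simp only [Function.comp_apply] at this
    rwa [Fin.succAbove_of_castSucc_lt _ _ (by simp [Fin.lt_def]; omega),
      Fin.succAbove_of_castSucc_lt _ _ (by simp [Fin.lt_def]; omega)] at this
  · have h' := hi.1
    rw [dif_pos (by omega)] at h'
    have he : (⟨j + 1, hj⟩ : Fin (n + 1)) = i := Fin.ext h
    have he' : (⟨j, by omega⟩ : Fin (n + 1)) = ⟨i - 1, by omega⟩ := Fin.ext (by simp; omega)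
    rw [he, he']
    by_contra hc
    simp [unitWeight, hc] at h'
  · rcases Nat.lt_or_ge (i : ℕ) j with h3 | h3
    · have := hx (j - 1) (by omega)
      simp only [Function.comp_apply] at this
      rw [Fin.succAbove_of_le_castSucc _ _ (by simp [Fin.le_def]; omega),
        Fin.succAbove_of_le_castSucc _ _ (by simp [Fin.le_def]; omega)] at this
      convert this using 2
      · exact Fin.ext (by simp; omega)
      · exact Fin.ext (by simp; omega)
    · have h' := hi.2
      rw [dif_pos (by omega)] at h'
      have he : (⟨j, by omega⟩ : Fin (n + 1)) = i := Fin.ext (by simp; omega)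
      have he' : (⟨j + 1, hj⟩ : Fin (n + 1)) = ⟨i + 1, by omega⟩ := Fin.ext (by simp; omega)
      rw [he, he']
      by_contra hc
      simp [unitWeight, hc] at h'

lemma buildingCount_eq_zero (G : SimpleGraph V) {n : ℕ} (x : Fin n → V) (hx : ¬ IsPathWord G x) :
    buildingCount G x = 0 := by
  induction n with
  | zero => exact absurd (fun j h => absurd h (by omega)) hx
  | succ n ih =>
    rw [buildingCount, weightedBuildingCount_succ]
    refine Finset.sum_eq_zero fun i _ => ?_
    by_cases hi : insertionWeight (unitWeight G) x i = 0
    · rw [hi, zero_mul]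
    · have := ih (x ∘ i.succAbove) fun h => hx (isPathWord_of_insertionWeight_ne_zero G hi h)
      rw [buildingCount] at this
      rw [this, mul_zero]

lemma buildingCount_succ (G : SimpleGraph V) {n : ℕ} {x : Fin (n + 1) → V} (hx : IsPathWord G x) :
    buildingCount G x = ∑ i : Fin (n + 1), buildingCount G (x ∘ i.succAbove) := by
  rw [buildingCount, weightedBuildingCount_succ]
  refine Finset.sum_congr rfl fun i _ => ?_
  rw [insertionWeight_of_isPathWord G hx, one_mul, buildingCount]

/-- The sum of `f` over the words obtained from a word by deleting one symbol. -/
def delSum : (List V → ℝ) → List V → ℝ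
  | _, [] => 0
  | f, a :: l => f l + delSum (fun t => f (a :: t)) l

@[simp] lemma delSum_nil (f : List V → ℝ) : delSum f [] = 0 := rfl

@[simp] lemma delSum_cons (f : List V → ℝ) (a : V) (l : List V) :
    delSum f (a :: l) = f l + delSum (fun t => f (a :: t)) l := rfl

lemma sum_ofFn_succAbove (f : List V → ℝ) {n : ℕ} (x : Fin (n + 1) → V) :
    ∑ i : Fin (n + 1), f (List.ofFn (x ∘ i.succAbove)) = delSum f (List.ofFn x) := by
  induction n generalizing f with
  | zero => simp
  | succ n ih =>
    rw [Fin.sum_univ_succ, List.ofFn_succ (f := x), delSum_cons, ← ih]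
    congr 1
    refine Finset.sum_congr rfl fun i _ => ?_
    rw [List.ofFn_succ]
    simp [Function.comp_def]

/-- The building count of a list. -/
def listCount (G : SimpleGraph V) (l : List V) : ℝ := buildingCount G l.get

lemma buildingCount_eq_listCount (G : SimpleGraph V) {n : ℕ} (x : Fin n → V) :
    buildingCount G x = listCount G (List.ofFn x) := by
  -- The length of `List.ofFn x` is only propositionally `n`, so the comparison passes through the
  -- sigma type.
  have key : ∀ (m : ℕ) (y : Fin m → V), (⟨n, x⟩ : Σ n, Fin n → V) = ⟨m, y⟩ →
      buildingCount G x = buildingCount G y := by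
    rintro m y h
    cases h
    rfl
  refine key _ _ ?_
  exact (List.equivSigmaTuple.right_inv ⟨n, x⟩).symm

@[simp] lemma listCount_nil (G : SimpleGraph V) : listCount G [] = 1 := by
  simp [listCount, buildingCount, weightedBuildingCount, buildingWeight]

lemma listCount_eq_zero (G : SimpleGraph V) {l : List V} (hl : ¬ l.IsChain G.Adj) :
    listCount G l = 0 :=
  buildingCount_eq_zero G _ (by rwa [isPathWord_iff_isChain, List.ofFn_get])

lemma listCount_eq_delSum (G : SimpleGraph V) {l : List V} (hl : l.IsChain G.Adj) (h0 : l ≠ []) :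
    listCount G l = delSum (listCount G) l := by
  obtain ⟨n, x, rfl⟩ : ∃ (n : ℕ) (x : Fin (n + 1) → V), l = List.ofFn x := by
    obtain ⟨a, t, rfl⟩ := List.exists_cons_of_ne_nil h0
    exact ⟨t.length, (a :: t).get, (List.ofFn_get _).symm⟩
  rw [← buildingCount_eq_listCount, buildingCount_succ G ((isPathWord_iff_isChain G x).2 hl),
    ← sum_ofFn_succAbove]
  simp only [buildingCount_eq_listCount]

end InsertionProcess

end

/-! ### Calculus of deletion sums, word sums and gap sums -/

noncomputable section

namespace InsertionProcess

variable {V : Type*}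

lemma delSum_congr {f g : List V → ℝ} (l : List V)
    (h : ∀ t : List V, t.length + 1 = l.length → f t = g t) : delSum f l = delSum g l := by
  induction l generalizing f g with
  | nil => rfl
  | cons a l ih =>
    rw [delSum_cons, delSum_cons, h l rfl]
    congr 1
    exact ih fun t ht => h _ (by simpa using ht)

lemma delSum_zero (l : List V) : delSum (fun _ => 0) l = 0 := by
  induction l with
  | nil => rfl
  | cons a l ih => rw [delSum_cons, ih, zero_add]

lemma delSum_mul (c : ℝ) (f : List V → ℝ) (l : List V) :
    delSum (fun t => c * f t) l = c * delSum f l := by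
  induction l generalizing f with
  | nil => simp
  | cons a l ih => rw [delSum_cons, delSum_cons, ih (fun t => f (a :: t)), mul_add]

lemma delSum_add (f g : List V → ℝ) (l : List V) :
    delSum (fun t => f t + g t) l = delSum f l + delSum g l := by
  induction l generalizing f g with
  | nil => simp
  | cons a l ih => simp only [delSum_cons, ih]; ring

lemma delSum_sum {ι : Type*} (s : Finset ι) (f : ι → List V → ℝ) (l : List V) :
    delSum (fun t => ∑ i ∈ s, f i t) l = ∑ i ∈ s, delSum (f i) l := by
  classical
  induction s using Finset.induction_on with
  | empty => simp [delSum_zero]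
  | insert i s hi ih => simp only [Finset.sum_insert hi, delSum_add, ih]

lemma delSum_append (f : List V → ℝ) (x y : List V) :
    delSum f (x ++ y) = delSum (fun t => f (t ++ y)) x + delSum (fun t => f (x ++ t)) y := by
  induction x generalizing f with
  | nil => simp
  | cons a x ih => simp only [List.cons_append, delSum_cons, ih]; ring

lemma delSum_reverse (f : List V → ℝ) (l : List V) :
    delSum f l.reverse = delSum (fun t => f t.reverse) l := by
  induction l generalizing f with
  | nil => rfl
  | cons a l ih => simp [delSum_append, ih, add_comm]

/-- Both the path condition and the deletion recursion are invariant under reversal. -/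
lemma listCount_reverse (G : SimpleGraph V) (l : List V) :
    listCount G l.reverse = listCount G l := by
  have hchain : ∀ l : List V, l.reverse.IsChain G.Adj ↔ l.IsChain G.Adj := fun l => by
    rw [List.isChain_reverse]
    exact ⟨fun h => h.imp fun _ _ h => h.symm, fun h => h.imp fun _ _ h => h.symm⟩
  induction h : l.length using Nat.strong_induction_on generalizing l with
  | _ n ih =>
    by_cases hl : l.IsChain G.Adj
    · rcases eq_or_ne l [] with rfl | h0
      · rfl
      · rw [listCount_eq_delSum G hl h0,
          listCount_eq_delSum G ((hchain l).2 hl) (by simpa using h0), delSum_reverse]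
        exact delSum_congr _ fun t ht => ih t.length (by omega) t rfl
    · rw [listCount_eq_zero G hl, listCount_eq_zero G (mt (hchain l).1 hl)]

lemma listCount_append_cons_cons (G : SimpleGraph V) {a b : V} (h : ¬ G.Adj a b) (x y : List V) :
    listCount G (x ++ a :: b :: y) = 0 :=
  listCount_eq_zero G fun hc => h (List.isChain_append_cons_cons.1 hc).2.1

@[simp] lemma listCount_singleton (G : SimpleGraph V) (a : V) : listCount G [a] = 1 := by
  rw [listCount_eq_delSum G (List.IsChain.singleton a) (by simp)]
  simp

lemma listCount_pair (G : SimpleGraph V) (a b : V) : listCount G [a, b] = 2 * unitWeight G a b := by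
  by_cases h : G.Adj a b
  · rw [listCount_eq_delSum G (by simpa using h) (by simp)]
    simp [unitWeight, h]
    norm_num
  · rw [listCount_eq_zero G (by simpa using h)]
    simp [unitWeight, h]

section Words

variable [Fintype V]

/-- The sum of `f` over all words of length `n`. -/
def wordSum : ℕ → (List V → ℝ) → ℝ
  | 0, f => f []
  | n + 1, f => ∑ a, wordSum n fun u => f (a :: u)

@[simp] lemma wordSum_zero (f : List V → ℝ) : wordSum 0 f = f [] := rfl

lemma wordSum_succ (n : ℕ) (f : List V → ℝ) :
    wordSum (n + 1) f = ∑ a, wordSum n fun u => f (a :: u) := rfl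

lemma wordSum_congr {n : ℕ} {f g : List V → ℝ} (h : ∀ u, f u = g u) :
    wordSum n f = wordSum n g := by
  rw [funext h]

lemma wordSum_add (n : ℕ) (f g : List V → ℝ) :
    wordSum n (fun u => f u + g u) = wordSum n f + wordSum n g := by
  induction n generalizing f g with
  | zero => rfl
  | succ n ih => simp only [wordSum_succ, ih, Finset.sum_add_distrib]

lemma wordSum_mul (n : ℕ) (c : ℝ) (f : List V → ℝ) :
    wordSum n (fun u => c * f u) = c * wordSum n f := by
  induction n generalizing f with
  | zero => rfl
  | succ n ih => simp only [wordSum_succ, Finset.mul_sum, ← ih]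

lemma wordSum_zero_fun (n : ℕ) : wordSum n (fun _ : List V => 0) = 0 := by
  simpa using wordSum_mul n 0 (fun _ : List V => 0)

lemma wordSum_sum {ι : Type*} (s : Finset ι) (n : ℕ) (f : ι → List V → ℝ) :
    wordSum n (fun u => ∑ i ∈ s, f i u) = ∑ i ∈ s, wordSum n (f i) := by
  classical
  induction s using Finset.induction_on with
  | empty => simp [wordSum_zero_fun]
  | insert i s hi ih => simp only [Finset.sum_insert hi, wordSum_add, ih]

lemma wordSum_succ' (n : ℕ) (f : List V → ℝ) :
    wordSum (n + 1) f = ∑ a, wordSum n fun u => f (u ++ [a]) := by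
  induction n generalizing f with
  | zero => simp [wordSum_succ]
  | succ n ih =>
    rw [wordSum_succ, Finset.sum_congr rfl fun a _ => ih fun u => f (a :: u), Finset.sum_comm]
    simp only [wordSum_succ, List.cons_append]

lemma wordSum_eq_sum_ofFn (n : ℕ) (f : List V → ℝ) :
    wordSum n f = ∑ x : Fin n → V, f (List.ofFn x) := by
  induction n generalizing f with
  | zero => simp
  | succ n ih =>
    rw [wordSum_succ, ← (Fin.consEquiv fun _ => V).sum_comp, Fintype.sum_prod_type]
    simp [ih, Fin.consEquiv]

lemma wordSum_eq_one {p : List V → ℝ} (h0 : p [] = 1) (hsnoc : ∀ l, p l = ∑ v, p (l ++ [v]))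
    (n : ℕ) : wordSum n p = 1 := by
  induction n with
  | zero => exact h0
  | succ n ih =>
    rw [wordSum_succ', ← wordSum_sum, ← ih]
    exact wordSum_congr fun u => (hsnoc u).symm

lemma totalCount_eq_wordSum (G : SimpleGraph V) (n : ℕ) :
    totalCount G n = wordSum n (listCount G) := by
  simp only [totalCount, wordSum_eq_sum_ofFn, buildingCount_eq_listCount]

/-- The sum of the building counts of the words `x u y` over the words `u` of length `k`. -/
def gapSum (G : SimpleGraph V) (k : ℕ) (x y : List V) : ℝ :=
  wordSum k fun u => listCount G (x ++ u ++ y)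

@[simp] lemma gapSum_zero (G : SimpleGraph V) (x y : List V) :
    gapSum G 0 x y = listCount G (x ++ y) := by
  simp [gapSum]

lemma gapSum_succ (G : SimpleGraph V) (k : ℕ) (x y : List V) :
    gapSum G (k + 1) x y = ∑ a, gapSum G k (x ++ [a]) y := by
  simp [gapSum, wordSum_succ]

lemma gapSum_succ' (G : SimpleGraph V) (k : ℕ) (x y : List V) :
    gapSum G (k + 1) x y = ∑ a, gapSum G k x (a :: y) := by
  simp [gapSum, wordSum_succ']

lemma gapSum_eq_zero_left (G : SimpleGraph V) (k : ℕ) {x : List V} (hx : ¬ x.IsChain G.Adj)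
    (y : List V) : gapSum G k x y = 0 := by
  rw [gapSum, ← wordSum_zero_fun (V := V) k]
  exact wordSum_congr fun u => listCount_eq_zero G fun h => hx h.left_of_append.left_of_append

lemma gapSum_eq_zero_right (G : SimpleGraph V) (k : ℕ) (x : List V) {y : List V}
    (hy : ¬ y.IsChain G.Adj) : gapSum G k x y = 0 := by
  rw [gapSum, ← wordSum_zero_fun (V := V) k]
  exact wordSum_congr fun u => listCount_eq_zero G fun h => hy h.right_of_append

end Words

/-! ### Complete multipartite graphs: consistency and factorization of gap sums -/

section Multipartite

variable {ι : Type*} {G : SimpleGraph V} {c : V → ι}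

lemma delSum_congr_map {f : List V → ℝ} {l l' : List V} (h : l.map c = l'.map c)
    (hf : ∀ t t' : List V, t.length + 1 = l.length → t.map c = t'.map c → f t = f t') :
    delSum f l = delSum f l' := by
  -- Two functions are needed for the induction: the tails carry `f (a :: ·)` and `f (a' :: ·)` with
  -- possibly different heads.
  suffices H : ∀ (g : List V → ℝ), (∀ t t' : List V, t.length + 1 = l.length →
      t.map c = t'.map c → f t = g t') → delSum f l = delSum g l' from H f hf
  clear hf
  induction l generalizing f l' with
  | nil =>
    obtain rfl : l' = [] := by simpa using h.symm
    intros; rfl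
  | cons a l ih =>
    obtain ⟨a', m, rfl⟩ : ∃ a' m, l' = a' :: m :=
      List.exists_cons_of_ne_nil (by rintro rfl; simp at h)
    simp only [List.map_cons, List.cons.injEq] at h
    intro g hg
    rw [delSum_cons, delSum_cons, hg l m rfl h.2]
    congr 1
    refine ih h.2 _ fun t t' ht htt' => hg _ _ (by simpa using ht) ?_
    simp [h.1, htt']

lemma isChain_iff_map (hc : ∀ a b, G.Adj a b ↔ c a ≠ c b)
    (l : List V) : l.IsChain G.Adj ↔ (l.map c).IsChain (· ≠ ·) := by
  rw [List.isChain_map]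
  simp only [← hc]

lemma listCount_congr_map (hc : ∀ a b, G.Adj a b ↔ c a ≠ c b)
    {l l' : List V} (h : l.map c = l'.map c) :
    listCount G l = listCount G l' := by
  induction hn : l.length using Nat.strong_induction_on generalizing l l' with
  | _ n ih =>
    by_cases hl : l.IsChain G.Adj
    · have hl' : l'.IsChain G.Adj := by rwa [isChain_iff_map hc, ← h, ← isChain_iff_map hc]
      rcases eq_or_ne l [] with rfl | h0
      · obtain rfl : l' = [] := by simpa using h.symm
        rfl
      · have h0' : l' ≠ [] := by rintro rfl; simp at h; exact h0 h
        rw [listCount_eq_delSum G hl h0, listCount_eq_delSum G hl' h0']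
        exact delSum_congr_map h fun t t' ht htt' => ih t.length (by omega) htt' rfl
    · have hl' : ¬ l'.IsChain G.Adj := by rwa [isChain_iff_map hc, ← h, ← isChain_iff_map hc]
      rw [listCount_eq_zero G hl, listCount_eq_zero G hl']

/-- If `a` differs in colour from `p` and `s`, this is the deletion recursion, the deletion of `a`
giving coefficient one. If `a` has the colour of `p` only, the left side is zero, and the only
surviving deletion is that of `p`, which leaves `a` in its place; the coefficient `1 - 2` cancels
it. The case of `s` is symmetric, and if all three colours agree every term is zero. The coefficient
is split in two so that `sum_color_indicator` applies to each end. -/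
lemma listCount_append_cons_append [DecidableEq ι]
    (hc : ∀ a b, G.Adj a b ↔ c a ≠ c b)
    {x y : List V} {p s : V} (hx : (x ++ [p]).IsChain G.Adj)
    (hy : (s :: y).IsChain G.Adj) (a : V) :
    listCount G (x ++ [p] ++ a :: s :: y) =
      delSum (fun t => listCount G (t ++ a :: s :: y)) (x ++ [p]) +
      delSum (fun t => listCount G (x ++ [p] ++ a :: t)) (s :: y) +
      (1 + -2 * (if c a = c p then 1 else 0) + (0 + -2 * if c a = c s then 1 else 0)) *
        listCount G (x ++ [p] ++ s :: y) := by
  have hps : c p = c s → listCount G (x ++ p :: s :: y) = 0 := fun h =>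
    listCount_append_cons_cons G (by rw [hc]; simpa using h) x y
  have hpa : c a = c p → ∀ t t' : List V, listCount G (t ++ p :: a :: t') = 0 := fun h =>
    listCount_append_cons_cons G (by rw [hc]; simpa using h.symm)
  have has : c a = c s → ∀ t t' : List V, listCount G (t ++ a :: s :: t') = 0 := fun h =>
    listCount_append_cons_cons G (by rw [hc]; simpa using h)
  have has' : c a = c s → ∀ t t' : List V, listCount G (t ++ p :: a :: s :: t') = 0 :=
    fun h t t' => by simpa using has h (t ++ [p]) t'
  have hap : c a = c p → listCount G (x ++ a :: s :: y) = listCount G (x ++ p :: s :: y) := fun h =>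
    listCount_congr_map hc (by simp [h])
  have hsa : c a = c s → listCount G (x ++ p :: a :: y) = listCount G (x ++ p :: s :: y) := fun h =>
    listCount_congr_map hc (by simp [h])
  by_cases h1 : c a = c p
  · by_cases h2 : c a = c s
    · have := hps (h1.symm.trans h2)
      simp [delSum_append, hpa h1, has h2, this, delSum_zero]
    · simp [delSum_append, hpa h1, hap h1, h1, h1 ▸ h2, delSum_zero]
      ring
  · by_cases h2 : c a = c s
    · simp [delSum_append, has h2, has' h2, hsa h2, h2, h2 ▸ h1, delSum_zero]
      ring
    · rw [listCount_eq_delSum G _ (by simp)]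
      · simp [delSum_append, h1, h2]
        ring
      · rw [List.append_assoc]
        refine List.isChain_append_cons_cons.2 ⟨hx, (hc _ _).2 (Ne.symm h1), ?_⟩
        exact List.isChain_cons_cons.2 ⟨(hc _ _).2 h2, hy⟩

variable [Fintype V]

lemma gapSum_congr_map (hc : ∀ a b, G.Adj a b ↔ c a ≠ c b)
    (k : ℕ) {x x' : List V} (h : x.map c = x'.map c) (y : List V) :
    gapSum G k x y = gapSum G k x' y :=
  wordSum_congr fun u => listCount_congr_map hc (by simp [h])

variable [DecidableEq ι] {m r : ℝ}

lemma sum_color_indicator (hr : ∀ a, ((Finset.univ.filter fun b => c b = c a).card : ℝ) = r)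
    (hm : (Fintype.card V : ℝ) = m * r)
    (s t : ℝ) (p : V) :
    ∑ a, (s + t * if c a = c p then 1 else 0) = (m * s + t) * r := by
  rw [Finset.sum_add_distrib, ← Finset.mul_sum, Finset.sum_boole, hr]
  simp [hm]
  ring

/-- Right consistency of the building counts of a balanced complete multipartite graph. -/
lemma sum_listCount_append_singleton (hc : ∀ a b, G.Adj a b ↔ c a ≠ c b)
    (hr : ∀ a, ((Finset.univ.filter fun b => c b = c a).card : ℝ) = r)
    (hm : (Fintype.card V : ℝ) = m * r)
    (x : List V) :
    ∑ a, listCount G (x ++ [a]) = (m + x.length * (m - 2)) * r * listCount G x := by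
  induction hn : x.length generalizing x with
  | zero =>
    obtain rfl : x = [] := List.length_eq_zero_iff.1 hn
    simp [hm]
  | succ n ih =>
    by_cases hx : x.IsChain G.Adj
    swap
    · rw [listCount_eq_zero G hx, mul_zero]
      exact Finset.sum_eq_zero fun a _ => listCount_eq_zero G fun h => hx h.left_of_append
    obtain ⟨x, p, rfl⟩ : ∃ x' p, x = x' ++ [p] := by
      rcases List.eq_nil_or_concat x with rfl | ⟨x', p, h⟩
      · simp at hn
      · exact ⟨x', p, by simpa using h⟩
    -- The same cancellation with one neighbour: the coefficient sums over `a` to `(m - 2) * r`, the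
    -- increment per letter of the constant.
    have key : ∀ a, listCount G (x ++ [p] ++ [a]) =
        delSum (fun t => listCount G (t ++ [a])) (x ++ [p]) +
          (1 + -2 * if c a = c p then 1 else 0) * listCount G (x ++ [p]) := by
      intro a
      by_cases ha : c a = c p
      · have hpa : ¬ G.Adj p a := by rw [hc]; simpa using ha.symm
        have h1 : ∀ t : List V, listCount G (t ++ [p, a]) = 0 := fun t =>
          listCount_append_cons_cons G hpa t []
        have h2 : listCount G (x ++ [a]) = listCount G (x ++ [p]) :=
          listCount_congr_map hc (by simp [ha])
        simp [delSum_append, ha, h1, h2, delSum_zero]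
        ring
      · have hpa : G.Adj p a := by rw [hc]; exact fun h => ha h.symm
        rw [listCount_eq_delSum G _ (by simp)]
        · simp [delSum_append, ha, add_assoc]
        · rw [List.append_assoc]
          exact List.isChain_append_cons_cons.2 ⟨hx, hpa, List.IsChain.singleton a⟩
    rw [Finset.sum_congr rfl fun a _ => key a, Finset.sum_add_distrib, ← Finset.sum_mul,
      sum_color_indicator hr hm]
    rw [← delSum_sum, delSum_congr (g := fun t => (m + n * (m - 2)) * r * listCount G t),
      delSum_mul, ← listCount_eq_delSum G hx (by simp)]
    · push_cast; ring
    · intro t ht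
      exact ih t (by omega)

/-- Left consistency of the building counts of a balanced complete multipartite graph. -/
lemma sum_listCount_cons (hc : ∀ a b, G.Adj a b ↔ c a ≠ c b)
    (hr : ∀ a, ((Finset.univ.filter fun b => c b = c a).card : ℝ) = r)
    (hm : (Fintype.card V : ℝ) = m * r)
    (x : List V) :
    ∑ a, listCount G (a :: x) = (m + x.length * (m - 2)) * r * listCount G x := by
  rw [← listCount_reverse G x, ← List.length_reverse (as := x),
    ← sum_listCount_append_singleton hc hr hm]
  refine Finset.sum_congr rfl fun a _ => ?_
  rw [← listCount_reverse, List.reverse_cons]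

/-- Summed over the gap letter, the coefficient one gives `m * r`, and the correction at each of the
two ends removes `2 * r`. -/
lemma gapSum_one (hc : ∀ a b, G.Adj a b ↔ c a ≠ c b)
    (hr : ∀ a, ((Finset.univ.filter fun b => c b = c a).card : ℝ) = r)
    (hm : (Fintype.card V : ℝ) = m * r)
    {x y : List V} {p s : V} (hx : (x ++ [p]).IsChain G.Adj)
    (hy : (s :: y).IsChain G.Adj) :
    gapSum G 1 (x ++ [p]) (s :: y) =
      delSum (fun t => gapSum G 1 t (s :: y)) (x ++ [p]) +
      delSum (fun t => gapSum G 1 (x ++ [p]) t) (s :: y) +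
      (m - 4) * r * gapSum G 0 (x ++ [p]) (s :: y) := by
  simp only [gapSum_succ', gapSum_zero, listCount_append_cons_append hc hx hy,
    Finset.sum_add_distrib, delSum_sum, ← Finset.sum_mul]
  have h1 := sum_color_indicator hr hm 1 (-2) p
  have h2 := sum_color_indicator hr hm 0 (-2) s
  rw [Finset.sum_add_distrib] at h1 h2
  rw [h1, h2]
  ring

/-- The first gap letter `a` is moved into the left word, where `ih` applies. Deleting `a` itself
gives a new term, and only the contact with `p` needs a correction, so the coefficient grows by `m -
2`. -/
lemma gapSum_succ_succ (hc : ∀ a b, G.Adj a b ↔ c a ≠ c b)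
    (hr : ∀ a, ((Finset.univ.filter fun b => c b = c a).card : ℝ) = r)
    (hm : (Fintype.card V : ℝ) = m * r)
    {k : ℕ} {e : ℝ} (ih : ∀ (x y : List V) (p s : V),
      (x ++ [p]).IsChain G.Adj → (s :: y).IsChain G.Adj →
      gapSum G (k + 1) (x ++ [p]) (s :: y) =
        delSum (fun t => gapSum G (k + 1) t (s :: y)) (x ++ [p]) +
        delSum (fun t => gapSum G (k + 1) (x ++ [p]) t) (s :: y) +
        e * r * gapSum G k (x ++ [p]) (s :: y))
    {x y : List V} {p s : V} (hx : (x ++ [p]).IsChain G.Adj) (hy : (s :: y).IsChain G.Adj) :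
    gapSum G (k + 2) (x ++ [p]) (s :: y) =
      delSum (fun t => gapSum G (k + 2) t (s :: y)) (x ++ [p]) +
      delSum (fun t => gapSum G (k + 2) (x ++ [p]) t) (s :: y) +
      (e + m - 2) * r * gapSum G (k + 1) (x ++ [p]) (s :: y) := by
  have key : ∀ a, gapSum G (k + 1) (x ++ [p] ++ [a]) (s :: y) =
      delSum (fun t => gapSum G (k + 1) (t ++ [a]) (s :: y)) (x ++ [p]) +
      delSum (fun t => gapSum G (k + 1) (x ++ [p] ++ [a]) t) (s :: y) +
      (1 + -2 * if c a = c p then 1 else 0) * gapSum G (k + 1) (x ++ [p]) (s :: y) +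
      e * r * gapSum G k (x ++ [p] ++ [a]) (s :: y) := by
    intro a
    by_cases ha : c a = c p
    · have hpa : ¬ G.Adj p a := by rw [hc]; simpa using ha.symm
      have h1 : ∀ (j : ℕ) (t y : List V), gapSum G j (t ++ [p, a]) y = 0 := fun j t y =>
        gapSum_eq_zero_left G j (fun h => hpa (List.isChain_append_cons_cons.1 h).2.1) y
      have h2 : gapSum G (k + 1) (x ++ [a]) (s :: y) = gapSum G (k + 1) (x ++ [p]) (s :: y) :=
        gapSum_congr_map hc _ (by simp [ha]) _
      simp only [List.append_assoc, List.cons_append, List.nil_append, h1, ha, delSum_zero,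
        delSum_append, delSum_cons, delSum_nil, h2, if_true]
      ring
    · rw [ih (x ++ [p]) y a s _ hy, delSum_append _ (x ++ [p]) [a]]
      · simp [ha]
        ring
      · rw [List.append_assoc]
        exact List.isChain_append_cons_cons.2
          ⟨hx, (hc _ _).2 (Ne.symm ha), List.IsChain.singleton a⟩
  simp only [gapSum_succ G (k + 1), delSum_sum]
  rw [Finset.sum_congr rfl fun a _ => key a, Finset.sum_add_distrib, Finset.sum_add_distrib,
    Finset.sum_add_distrib, ← Finset.sum_mul, sum_color_indicator hr hm, ← Finset.mul_sum,
    ← gapSum_succ]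
  ring

/-- If the gap sums of length `k` satisfy the deletion recursion then they factorize. -/
lemma exists_gapSum_eq_mul (hc : ∀ a b, G.Adj a b ↔ c a ≠ c b)
    (hr : ∀ a, ((Finset.univ.filter fun b => c b = c a).card : ℝ) = r)
    (hm : (Fintype.card V : ℝ) = m * r)
    {k : ℕ} (hk : ∀ (x y : List V) (p s : V),
      (x ++ [p]).IsChain G.Adj → (s :: y).IsChain G.Adj →
      gapSum G k (x ++ [p]) (s :: y) =
        delSum (fun t => gapSum G k t (s :: y)) (x ++ [p]) +
        delSum (fun t => gapSum G k (x ++ [p]) t) (s :: y)) :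
    ∃ K : ℕ → ℕ → ℝ, ∀ x y : List V,
      gapSum G k x y = K x.length y.length * (listCount G x * listCount G y) := by
  -- With one word empty the gap is an end of the word, and consistency is applied letter by letter.
  have hleft : ∀ k : ℕ, ∃ C : ℕ → ℝ, ∀ y : List V,
      gapSum G k [] y = C y.length * listCount G y := by
    intro k
    induction k with
    | zero => exact ⟨fun _ => 1, by simp⟩
    | succ k ih =>
      obtain ⟨C, hC⟩ := ih
      refine ⟨fun n => C (n + 1) * ((m + n * (m - 2)) * r), fun y => ?_⟩
      simp only [gapSum_succ', hC, List.length_cons, ← Finset.mul_sum, sum_listCount_cons hc hr hm]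
      ring
  have hright : ∀ k : ℕ, ∃ C : ℕ → ℝ, ∀ x : List V,
      gapSum G k x [] = C x.length * listCount G x := by
    intro k
    induction k with
    | zero => exact ⟨fun _ => 1, by simp⟩
    | succ k ih =>
      obtain ⟨C, hC⟩ := ih
      refine ⟨fun n => C (n + 1) * ((m + n * (m - 2)) * r), fun y => ?_⟩
      simp only [gapSum_succ, hC, List.length_append, List.length_singleton, ← Finset.mul_sum,
        sum_listCount_append_singleton hc hr hm]
      ring
  suffices H : ∀ i j : ℕ, ∃ K : ℝ, ∀ x y : List V, x.length = i → y.length = j →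
      gapSum G k x y = K * (listCount G x * listCount G y) by
    choose K hK using H
    exact ⟨K, fun x y => hK _ _ x y rfl rfl⟩
  intro i
  induction i with
  | zero =>
    intro j
    obtain ⟨C, hC⟩ := hleft k
    refine ⟨C j, fun x y hx hy => ?_⟩
    obtain rfl : x = [] := List.length_eq_zero_iff.1 hx
    rw [hC, hy, listCount_nil, one_mul]
  | succ i ihi =>
    intro j
    induction j with
    | zero =>
      obtain ⟨C, hC⟩ := hright k
      refine ⟨C (i + 1), fun x y hx hy => ?_⟩
      obtain rfl : y = [] := List.length_eq_zero_iff.1 hy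
      rw [hC, hx, listCount_nil, mul_one]
    | succ j ihj =>
      obtain ⟨K₁, hK₁⟩ := ihi (j + 1)
      obtain ⟨K₂, hK₂⟩ := ihj
      -- Pascal's rule: by induction each of the two deletion sums collapses, through
      -- `listCount_eq_delSum`, to a multiple of the same product.
      refine ⟨K₁ + K₂, fun x y hx hy => ?_⟩
      by_cases hxc : x.IsChain G.Adj
      swap
      · rw [gapSum_eq_zero_left G k hxc, listCount_eq_zero G hxc]; ring
      by_cases hyc : y.IsChain G.Adj
      swap
      · rw [gapSum_eq_zero_right G k x hyc, listCount_eq_zero G hyc]; ring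
      have e1 : delSum (fun t => gapSum G k t y) x = K₁ * (listCount G x * listCount G y) := by
        rw [delSum_congr (g := fun t => K₁ * listCount G y * listCount G t), delSum_mul,
          ← listCount_eq_delSum G hxc (by rintro rfl; simp at hx)]
        · ring
        · intro t ht
          rw [hK₁ t y (by omega) hy]; ring
      have e2 : delSum (fun t => gapSum G k x t) y = K₂ * (listCount G x * listCount G y) := by
        rw [delSum_congr (g := fun t => K₂ * listCount G x * listCount G t), delSum_mul,
          ← listCount_eq_delSum G hyc (by rintro rfl; simp at hy)]
        · ring
        · intro t ht
          rw [hK₂ x t hx (by omega)]; ring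
      rw [add_mul, ← e1, ← e2]
      obtain ⟨x, p, rfl⟩ : ∃ x' p, x = x' ++ [p] := by
        rcases List.eq_nil_or_concat x with rfl | ⟨x', p, h⟩
        · simp at hx
        · exact ⟨x', p, by simpa using h⟩
      obtain ⟨s, y, rfl⟩ : ∃ s y', y = s :: y' :=
        List.exists_cons_of_ne_nil (by rintro rfl; simp at hy)
      exact hk x y p s hxc hyc

lemma exists_gapSum_one_eq_mul (hc : ∀ a b, G.Adj a b ↔ c a ≠ c b)
    (hr : ∀ a, ((Finset.univ.filter fun b => c b = c a).card : ℝ) = r)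
    (hm : (Fintype.card V : ℝ) = m * r)
    (h4 : m = 4) : ∃ K : ℕ → ℕ → ℝ, ∀ x y : List V,
    gapSum G 1 x y = K x.length y.length * (listCount G x * listCount G y) := by
  refine exists_gapSum_eq_mul hc hr hm fun x y p s hx hy => ?_
  rw [gapSum_one hc hr hm hx hy, h4]
  ring

/-- The extra coefficient is `(m - 4) + (m - 2)`, which vanishes at `m = 3`. -/
lemma exists_gapSum_two_eq_mul (hc : ∀ a b, G.Adj a b ↔ c a ≠ c b)
    (hr : ∀ a, ((Finset.univ.filter fun b => c b = c a).card : ℝ) = r)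
    (hm : (Fintype.card V : ℝ) = m * r)
    (h3 : m = 3) : ∃ K : ℕ → ℕ → ℝ, ∀ x y : List V,
    gapSum G 2 x y = K x.length y.length * (listCount G x * listCount G y) := by
  refine exists_gapSum_eq_mul hc hr hm fun x y p s hx hy => ?_
  rw [gapSum_succ_succ hc hr hm (k := 0) (e := m - 4)
    (fun x y p s hx hy => gapSum_one hc hr hm hx hy) hx hy, h3]
  ring

end Multipartite

end InsertionProcess

end

/-! ### Measures on bi-infinite sequences from cylinder probabilities -/

noncomputable section

namespace InsertionProcess

variable {V : Type*}

/-- The bi-infinite sequences in which the word `l` occupies the positions `i + 1, i + 2, …`. -/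
def cyl : ℤ → List V → Set (ℤ → V)
  | _, [] => Set.univ
  | i, a :: l => {ω | ω (i + 1) = a} ∩ cyl (i + 1) l

@[simp] lemma cyl_nil (i : ℤ) : cyl i ([] : List V) = Set.univ := rfl

lemma cyl_cons (i : ℤ) (a : V) (l : List V) :
    cyl i (a :: l) = {ω | ω (i + 1) = a} ∩ cyl (i + 1) l := rfl

lemma cyl_append (i : ℤ) (x y : List V) : cyl i (x ++ y) = cyl i x ∩ cyl (i + x.length) y := by
  induction x generalizing i with
  | nil => simp
  | cons a x ih =>
    rw [List.cons_append, cyl_cons, cyl_cons, ih, Set.inter_assoc, List.length_cons]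
    congr 3
    push_cast
    ring

lemma cyl_append_singleton (i : ℤ) (x : List V) (v : V) :
    cyl i (x ++ [v]) = cyl i x ∩ {ω | ω (i + x.length + 1) = v} := by
  rw [cyl_append, cyl_cons, cyl_nil, Set.inter_univ]

lemma cyl_ofFn (i : ℤ) {n : ℕ} (x : Fin n → V) :
    cyl i (List.ofFn x) = {ω | ∀ j : Fin n, ω (i + 1 + (j : ℕ)) = x j} := by
  induction n generalizing i with
  | zero => simp
  | succ n ih =>
    rw [List.ofFn_succ, cyl_cons, ih]
    ext ω
    simp only [Set.mem_inter_iff, Set.mem_ofPred_eq, Fin.forall_fin_succ, Fin.val_zero,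
      Fin.val_succ]
    push_cast
    simp only [add_zero, add_assoc, add_comm (1 : ℤ)]

lemma cyl_preimage_shift (i : ℤ) (l : List V) :
    (fun (ω : ℤ → V) (j : ℤ) => ω (j + 1)) ⁻¹' cyl i l = cyl (i + 1) l := by
  induction l generalizing i with
  | nil => rfl
  | cons a l ih =>
    rw [cyl_cons, cyl_cons, Set.preimage_inter, ih]
    rfl

/-- The word at the positions `i + 1, …, i + n`. -/
def window (i : ℤ) (n : ℕ) (ω : ℤ → V) (j : Fin n) : V := ω (i + 1 + (j : ℕ))

lemma window_preimage_singleton (i : ℤ) {n : ℕ} (x : Fin n → V) :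
    window i n ⁻¹' {x} = cyl i (List.ofFn x) := by
  rw [cyl_ofFn]
  ext ω
  simp [window, funext_iff]

variable [MeasurableSpace V]

lemma measurable_window (i : ℤ) (n : ℕ) : Measurable (window (V := V) i n) :=
  measurable_pi_lambda _ fun _ => measurable_pi_apply _

lemma IsKDependent.mono {k k' : ℕ} (hk : k ≤ k') {μ : Measure (ℤ → V)} (h : IsKDependent k μ) :
    IsKDependent k' μ := by
  have hg : Measurable fun (z : {i : ℤ // (k : ℤ) ≤ i} → V) (i : {i : ℤ // (k' : ℤ) ≤ i}) =>
      z ⟨i, by have := i.2; omega⟩ := measurable_pi_lambda _ fun _ => measurable_pi_apply _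
  exact IndepFun.comp h measurable_id hg

variable [DiscreteMeasurableSpace V]

lemma measurableSet_coord (i : ℤ) (a : V) : MeasurableSet {ω : ℤ → V | ω i = a} :=
  (measurable_pi_apply (X := fun _ : ℤ => V) i) (MeasurableSet.of_discrete (s := {a}))

lemma measurableSet_cyl (i : ℤ) (l : List V) : MeasurableSet (cyl i l) := by
  induction l generalizing i with
  | nil => exact MeasurableSet.univ
  | cons a l ih => exact (measurableSet_coord _ a).inter (ih _)

variable [Fintype V]

lemma measureReal_eq_sum_coord (μ : Measure (ℤ → V)) [IsFiniteMeasure μ] (S : Set (ℤ → V))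
    (j : ℤ) : μ.real S = ∑ v, μ.real (S ∩ {ω | ω j = v}) := by
  have := sum_measureReal_preimage_singleton (μ := μ.restrict S) (f := fun ω : ℤ → V => ω j)
    Finset.univ fun v _ => measurableSet_coord j v
  rw [Finset.coe_univ, Set.preimage_univ, measureReal_restrict_apply_univ] at this
  rw [← this]
  refine Finset.sum_congr rfl fun v _ => ?_
  rw [Set.inter_comm]
  exact measureReal_restrict_apply (measurableSet_coord j v)

lemma measureReal_cyl_eq_sum_append (μ : Measure (ℤ → V)) [IsFiniteMeasure μ] (i : ℤ)
    (l : List V) : μ.real (cyl i l) = ∑ v, μ.real (cyl i (l ++ [v])) := by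
  rw [measureReal_eq_sum_coord μ _ (i + l.length + 1)]
  simp only [cyl_append_singleton]

lemma measureReal_cyl_eq_sum_cons (μ : Measure (ℤ → V)) [IsFiniteMeasure μ] (i : ℤ)
    (l : List V) : μ.real (cyl (i + 1) l) = ∑ v, μ.real (cyl i (v :: l)) := by
  rw [measureReal_eq_sum_coord μ _ (i + 1)]
  simp only [cyl_cons, Set.inter_comm]

/-- Measures on bi-infinite sequences are determined by their cylinder probabilities. -/
lemma measure_ext_of_cyl {μ ν : Measure (ℤ → V)} [IsProbabilityMeasure μ] [IsProbabilityMeasure ν]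
    (h : ∀ i l, μ (cyl i l) = ν (cyl i l)) : μ = ν := by
  have hwin : ∀ i n, μ.map (window i n) = ν.map (window i n) := fun i n => by
    refine Measure.ext_of_singleton fun x => ?_
    rw [Measure.map_apply (measurable_window i n) (measurableSet_singleton x),
      Measure.map_apply (measurable_window i n) (measurableSet_singleton x),
      window_preimage_singleton, h]
  refine IsProjectiveLimit.unique (P := fun I : Finset ℤ => ν.map I.restrict) (fun I => ?_)
    (fun I => rfl)
  -- Every finite set of coordinates lies in a window `-N, …, N - 1`.
  obtain ⟨N, hN⟩ : ∃ N : ℕ, ∀ j ∈ I, j.natAbs < N := by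
    obtain ⟨N, hN⟩ := (I.image Int.natAbs).exists_nat_subset_range
    exact ⟨N, fun j hj => Finset.mem_range.1 (hN (Finset.mem_image_of_mem _ hj))⟩
  let g : (Fin (2 * N) → V) → (I → V) := fun z j =>
    z ⟨((j : ℤ) + N).toNat, by have := hN j j.2; omega⟩
  have hg : (I.restrict : (ℤ → V) → (I → V)) = g ∘ window (-N - 1) (2 * N) := by
    funext ω j
    have := hN j j.2
    simp only [Finset.restrict_def, g, Function.comp_apply, window]
    congr 1
    omega
  have hgm : Measurable g := measurable_pi_lambda _ fun _ => measurable_pi_apply _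
  beta_reduce
  rw [hg, ← Measure.map_map hgm (measurable_window _ _),
    ← Measure.map_map hgm (measurable_window _ _), hwin]

lemma isStationary_of_cyl {μ : Measure (ℤ → V)} [IsProbabilityMeasure μ] {p : List V → ENNReal}
    (h : ∀ i l, μ (cyl i l) = p l) : IsStationary μ := by
  have hm : Measurable fun (ω : ℤ → V) (i : ℤ) => ω (i + 1) :=
    measurable_pi_lambda _ fun _ => measurable_pi_apply _
  have := Measure.isProbabilityMeasure_map (μ := μ) hm.aemeasurable
  refine measure_ext_of_cyl fun i l => ?_
  rw [Measure.map_apply hm (measurableSet_cyl i l), cyl_preimage_shift, h, h]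

/-- Only one window is prescribed, so a finite mixture of Dirac masses suffices, with an arbitrary
letter outside the window. -/
lemma exists_measure_window [Nonempty V] {p : List V → ℝ} (h0 : p [] = 1) (hp : ∀ l, 0 ≤ p l)
    (hsnoc : ∀ l, p l = ∑ v, p (l ++ [v])) (i : ℤ) (n : ℕ) :
    ∃ μ : Measure (ℤ → V), IsProbabilityMeasure μ ∧
      ∀ l, l.length = n → μ.real (cyl i l) = p l := by
  let e : (Fin n → V) → ℤ → V := fun x j =>
    if h : (j - i - 1).toNat < n then x ⟨_, h⟩ else Classical.arbitrary V
  have he : ∀ x y : Fin n → V, e x ∈ cyl i (List.ofFn y) ↔ x = y := by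
    intro x y
    rw [cyl_ofFn, funext_iff]
    refine forall_congr' fun j => ?_
    have hj : (i + 1 + ((j : ℕ) : ℤ) - i - 1).toNat = j := by omega
    simp only [e, hj, dif_pos j.2]
  let μ : Measure (ℤ → V) :=
    ∑ x : Fin n → V, ENNReal.ofReal (p (List.ofFn x)) • Measure.dirac (e x)
  have hμ : IsProbabilityMeasure μ := by
    constructor
    simp only [μ, Measure.finsetSum_apply, Measure.smul_apply, measure_univ, smul_eq_mul, mul_one]
    rw [← ENNReal.ofReal_sum_of_nonneg fun x _ => hp _, ← wordSum_eq_sum_ofFn,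
      wordSum_eq_one h0 hsnoc, ENNReal.ofReal_one]
  refine ⟨μ, hμ, ?_⟩
  rintro l rfl
  have hl : cyl i l = cyl i (List.ofFn l.get) := by rw [List.ofFn_get]
  rw [measureReal_def]
  simp only [μ, Measure.finsetSum_apply, Measure.smul_apply, smul_eq_mul,
    Measure.dirac_apply' _ (measurableSet_cyl i l)]
  rw [Finset.sum_eq_single l.get]
  · rw [hl, Set.indicator_of_mem ((he _ _).2 rfl)]
    simp [hp]
  · intro x _ hx
    rw [hl, Set.indicator_of_notMem fun h => hx ((he _ _).1 h), mul_zero]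
  · simp

/-- A shorter word is extended to the full window by summing over the `t` missing letters on the
right and the `s` missing ones on the left. -/
lemma measureReal_cyl_of_window {p : List V → ℝ} (hsnoc : ∀ l, p l = ∑ v, p (l ++ [v]))
    (hcons : ∀ l, p l = ∑ v, p (v :: l)) {μ : Measure (ℤ → V)} [IsProbabilityMeasure μ]
    {i : ℤ} {n : ℕ} (h : ∀ l, l.length = n → μ.real (cyl i l) = p l) (s t : ℕ) (l : List V)
    (hl : s + l.length + t = n) : μ.real (cyl (i + s) l) = p l := by
  induction t generalizing l with
  | succ t ih =>
    rw [measureReal_cyl_eq_sum_append, hsnoc l]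
    exact Finset.sum_congr rfl fun v _ => ih _ (by simp; omega)
  | zero =>
    induction s generalizing l with
    | zero => simpa using h l (by omega)
    | succ s ih =>
      push_cast
      rw [← add_assoc, measureReal_cyl_eq_sum_cons, hcons l]
      exact Finset.sum_congr rfl fun v _ => ih _ (by simp; omega)

/-- Kolmogorov extension for consistent families of word probabilities over a finite alphabet. -/
lemma exists_measure_cyl {p : List V → ℝ} (h0 : p [] = 1) (hp : ∀ l, 0 ≤ p l)
    (hsnoc : ∀ l, p l = ∑ v, p (l ++ [v])) (hcons : ∀ l, p l = ∑ v, p (v :: l)) :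
    ∃ μ : Measure (ℤ → V), IsProbabilityMeasure μ ∧ ∀ i l, μ (cyl i l) = ENNReal.ofReal (p l) := by
  have hne : Nonempty V := by
    by_contra hV
    rw [not_nonempty_iff] at hV
    have := hsnoc []
    simp [h0] at this
  let _ : TopologicalSpace V := ⊥
  have : DiscreteTopology V := ⟨rfl⟩
  have hclopen : ∀ (l : List V) (i : ℤ), IsClopen (cyl i l) := by
    intro l
    induction l with
    | nil => exact fun _ => isClopen_univ
    | cons a l ih =>
      exact fun i => ((isClopen_discrete {a}).preimage (continuous_apply (i + 1))).inter (ih _)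
  choose ν hν hνp using fun N : ℕ => exists_measure_window h0 hp hsnoc (-N) (2 * N)
  let ρ : ℕ → ProbabilityMeasure (ℤ → V) := fun N => ⟨ν N, hν N⟩
  -- The sequence space is compact, hence so is its space of probability measures, and an
  -- ultrafilter limit exists. Cylinders are clopen, so their probabilities pass to this limit.
  obtain ⟨μ, hμ⟩ : ∃ μ, Filter.Tendsto ρ (Filter.hyperfilter ℕ) (nhds μ) :=
    ⟨_, ((Filter.hyperfilter ℕ).map ρ).le_nhds_lim⟩
  refine ⟨μ, μ.2, fun i l => ?_⟩
  have h1 := ProbabilityMeasure.tendsto_measure_of_isClopen_of_tendsto hμ (hclopen l i)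
  have h2 : Filter.Tendsto (fun N => ρ N (cyl i l)) (Filter.hyperfilter ℕ)
      (nhds (p l).toNNReal) := by
    refine Filter.Tendsto.mono_left ?_ Nat.hyperfilter_le_atTop
    refine tendsto_const_nhds.congr' ?_
    -- From here on the word lies inside the window `-N + 1, …, N`, and its probability is exactly
    -- `p l`.
    filter_upwards [Filter.eventually_ge_atTop (i.natAbs + l.length)] with N hN
    have := measureReal_cyl_of_window hsnoc hcons (hνp N) (i + N).toNat
      (2 * N - (i + N).toNat - l.length) l (by omega)
    have hi : (-N : ℤ) + ((i + N).toNat : ℤ) = i := by omega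
    rw [hi] at this
    rw [← this]
    ext
    simp [ρ, measureReal_def]
  have h3 := tendsto_nhds_unique h1 h2
  rw [← ProbabilityMeasure.ennreal_coeFn_eq_coeFn_toMeasure, h3]
  rfl

/-- Independence of the past and the future beyond a gap, from cylinder probabilities. -/
lemma isKDependent_of_cyl {k : ℕ} {μ : Measure (ℤ → V)} [IsProbabilityMeasure μ]
    (h : ∀ x y : List V, μ (cyl (-1 - x.length) x ∩ cyl (k - 1) y) =
      μ (cyl (-1 - x.length) x) * μ (cyl (k - 1) y)) : IsKDependent k μ := by
  -- These windows occupy `-n, …, -1` and `k, …, k + n' - 1`. They increase with `n` and `n'`, so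
  -- independence extends to the generated σ-algebras, one side at a time.
  have hwin : ∀ n n' : ℕ, Indep (MeasurableSpace.comap (window (V := V) (-1 - n) n) inferInstance)
      (MeasurableSpace.comap (window (V := V) (k - 1) n') inferInstance) μ := by
    intro n n'
    change IndepFun (window (V := V) (-1 - n) n) (window (V := V) (k - 1) n') μ
    rw [indepFun_iff_map_prod_eq_prod_map_map (measurable_window _ _).aemeasurable
      (measurable_window _ _).aemeasurable]
    refine Measure.ext_of_singleton fun ⟨x, y⟩ => ?_
    rw [← Set.singleton_prod_singleton, Measure.prod_prod,
      Measure.map_apply (measurable_window _ _) (measurableSet_singleton x),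
      Measure.map_apply (measurable_window _ _) (measurableSet_singleton y),
      Measure.map_apply ((measurable_window _ _).prodMk (measurable_window _ _))
        ((measurableSet_singleton x).prod (measurableSet_singleton y)), Set.mk_preimage_prod,
      window_preimage_singleton, window_preimage_singleton]
    simpa using h (List.ofFn x) (List.ofFn y)
  have hleL : ∀ n : ℕ, MeasurableSpace.comap (window (V := V) (-1 - n) n) inferInstance ≤
      MeasurableSpace.pi := fun n => (measurable_window _ _).comap_le
  have hleR : ∀ n : ℕ, MeasurableSpace.comap (window (V := V) (k - 1) n) inferInstance ≤
      MeasurableSpace.pi := fun n => (measurable_window _ _).comap_le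
  have hmonoL : Monotone fun n : ℕ =>
      MeasurableSpace.comap (window (V := V) (-1 - n) n) inferInstance := by
    refine monotone_nat_of_le_succ fun n => ?_
    have : window (V := V) (-1 - n) n =
        (fun z : Fin (n + 1) → V => fun j : Fin n => z j.succ) ∘
          window (-1 - ((n + 1 : ℕ) : ℤ)) (n + 1) := by
      funext ω j
      simp only [window, Function.comp_apply, Fin.val_succ]
      congr 1
      push_cast
      ring
    rw [this, ← MeasurableSpace.comap_comp]
    exact MeasurableSpace.comap_mono
      (measurable_pi_lambda _ fun _ => measurable_pi_apply _ : Measurable _).comap_le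
  have hmonoR : Monotone fun n : ℕ =>
      MeasurableSpace.comap (window (V := V) (k - 1) n) inferInstance := by
    refine monotone_nat_of_le_succ fun n => ?_
    have : window (V := V) (k - 1) n =
        (fun z : Fin (n + 1) → V => fun j : Fin n => z j.castSucc) ∘ window (k - 1) (n + 1) := by
      funext ω j
      rfl
    rw [this, ← MeasurableSpace.comap_comp]
    exact MeasurableSpace.comap_mono
      (measurable_pi_lambda _ fun _ => measurable_pi_apply _ : Measurable _).comap_le
  have hsup : Indep (⨆ n : ℕ, MeasurableSpace.comap (window (V := V) (-1 - n) n) inferInstance)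
      (⨆ n : ℕ, MeasurableSpace.comap (window (V := V) (k - 1) n) inferInstance) μ := by
    refine indep_iSup_of_monotone (fun n => ?_) hleL (iSup_le hleR) hmonoL
    exact (indep_iSup_of_monotone (fun n' => (hwin n n').symm) hleR (hleL n) hmonoR).symm
  have hcoord : ∀ (i : ℤ) (n : ℕ) (j : Fin n), Measurable[MeasurableSpace.comap
      (window (V := V) i n) inferInstance] fun ω : ℤ → V => ω (i + 1 + (j : ℕ)) := fun i n j =>
    (measurable_pi_apply j).comp (comap_measurable (window (V := V) i n))
  refine indep_of_indep_of_le_left (indep_of_indep_of_le_right hsup ?_) ?_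
  · rw [← measurable_iff_comap_le]
    refine @measurable_pi_lambda _ _ _ (_) _ _ fun i => ?_
    have hi := i.2
    refine Measurable.mono (?_ : Measurable[MeasurableSpace.comap
      (window (V := V) (k - 1) (((i : ℤ) - k).toNat + 1)) inferInstance] _)
      (le_iSup (fun n : ℕ => MeasurableSpace.comap (window (V := V) (k - 1) n) inferInstance) _)
      le_rfl
    have := hcoord (k - 1) (((i : ℤ) - k).toNat + 1) ⟨((i : ℤ) - k).toNat, by omega⟩
    have e : (k - 1 + 1 + (((i : ℤ) - k).toNat : ℤ) : ℤ) = i := by omega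
    simpa only [e] using this
  · rw [← measurable_iff_comap_le]
    refine @measurable_pi_lambda _ _ _ (_) _ _ fun i => ?_
    have hi := i.2
    refine Measurable.mono (?_ : Measurable[MeasurableSpace.comap
      (window (V := V) (-1 - ((-(i : ℤ)).toNat : ℤ)) ((-(i : ℤ)).toNat)) inferInstance] _)
      (le_iSup (fun n : ℕ => MeasurableSpace.comap (window (V := V) (-1 - n) n) inferInstance) _)
      le_rfl
    have := hcoord (-1 - ((-(i : ℤ)).toNat : ℤ)) ((-(i : ℤ)).toNat) ⟨0, by omega⟩
    have e : (-1 - ((-(i : ℤ)).toNat : ℤ) + 1 + ((0 : ℕ) : ℤ) : ℤ) = i := by omega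
    simpa only [e] using this

end InsertionProcess

end

/-! ### Sufficiency: from factorized gap sums to the insertion process -/

noncomputable section

namespace InsertionProcess

variable {V : Type*}

lemma listCount_nonneg (G : SimpleGraph V) (l : List V) : 0 ≤ listCount G l := by
  refine Finset.sum_nonneg fun σ _ => Finset.prod_nonneg fun t _ => ?_
  unfold unitWeight
  refine mul_nonneg ?_ ?_ <;> split_ifs <;> norm_num

variable [Fintype V]

lemma wordSum_congr_length {n : ℕ} {f g : List V → ℝ} (h : ∀ u, u.length = n → f u = g u) :
    wordSum n f = wordSum n g := by
  rw [wordSum_eq_sum_ofFn, wordSum_eq_sum_ofFn]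
  exact Finset.sum_congr rfl fun x _ => h _ List.length_ofFn

lemma wordSum_add_length (a b : ℕ) (f : List V → ℝ) :
    wordSum (a + b) f = wordSum a fun u => wordSum b fun v => f (u ++ v) := by
  induction a generalizing f with
  | zero => simp
  | succ a ih => rw [Nat.succ_add]; simp only [wordSum_succ, ih, List.cons_append]

lemma wordSum_comm (a b : ℕ) (f : List V → List V → ℝ) :
    wordSum a (fun x => wordSum b fun y => f x y) =
      wordSum b fun y => wordSum a fun x => f x y := by
  simp only [wordSum_eq_sum_ofFn]
  exact Finset.sum_comm

lemma wordSum_gapSum (G : SimpleGraph V) (a k b : ℕ) :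
    wordSum a (fun x => wordSum b fun y => gapSum G k x y) = totalCount G (a + k + b) := by
  rw [totalCount_eq_wordSum, add_assoc, wordSum_add_length]
  refine wordSum_congr fun x => ?_
  rw [wordSum_add_length, wordSum_comm]
  simp only [gapSum, List.append_assoc]

/-- The probability which the insertion algorithm assigns to a list. -/
def listProb (G : SimpleGraph V) (l : List V) : ℝ := listCount G l / totalCount G l.length

lemma wordProb_eq_listProb (G : SimpleGraph V) {n : ℕ} (x : Fin n → V) :
    wordProb G x = listProb G (List.ofFn x) := by
  rw [wordProb, listProb, buildingCount_eq_listCount, List.length_ofFn]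

lemma isConsistent_iff (G : SimpleGraph V) : IsConsistent G ↔ (∀ n, 0 < totalCount G n) ∧
    ∀ l, listProb G l = ∑ v, listProb G (l ++ [v]) ∧ listProb G l = ∑ v, listProb G (v :: l) := by
  have hsnoc : ∀ (n : ℕ) (x : Fin n → V) (v : V),
      List.ofFn (Fin.snoc x v : Fin (n + 1) → V) = List.ofFn x ++ [v] := fun n x v => by
    rw [List.ofFn_succ_last]
    simp
  refine and_congr_right fun _ => ⟨fun h l => ?_, fun h n x => ?_⟩
  · have := h l.length l.get
    simpa only [wordProb_eq_listProb, hsnoc, List.ofFn_cons, List.ofFn_get] using this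
  · simpa only [wordProb_eq_listProb, hsnoc, List.ofFn_cons] using h (List.ofFn x)

/-- The colour classes of a graph isomorphic to a balanced complete multipartite graph. -/
lemma card_color_of_iso {G : SimpleGraph V} {m r : ℕ}
    (e : G ≃g SimpleGraph.completeMultipartiteGraph (fun _ : Fin m => Fin r)) :
    (∀ a b, G.Adj a b ↔ (e a).1 ≠ (e b).1) ∧
    (∀ a, (Finset.univ.filter fun b => (e b).1 = (e a).1).card = r) ∧
    Fintype.card V = m * r := by
  refine ⟨fun a b => ?_, fun a => ?_, ?_⟩
  · rw [← e.map_rel_iff]; rfl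
  · have : (Finset.univ.filter fun b => (e b).1 = (e a).1).card =
        (Finset.univ : Finset (Fin r)).card := by
      refine Finset.card_bij' (fun b _ => (e b).2) (fun s _ => e.symm ⟨(e a).1, s⟩) ?_ ?_ ?_ ?_
      · simp
      · simp
      · intro b hb
        simp only [Finset.mem_filter, Finset.mem_univ, true_and] at hb
        rw [← hb]
        exact e.symm_apply_apply b
      · intro s _
        simp
    simpa using this
  · rw [Fintype.card_congr e.toEquiv]
    simp

variable [MeasurableSpace V]

lemma isInsertionLaw_iff (G : SimpleGraph V) (μ : Measure (ℤ → V)) :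
    IsInsertionLaw G μ ↔
      IsProbabilityMeasure μ ∧ ∀ i l, μ (cyl i l) = ENNReal.ofReal (listProb G l) := by
  refine and_congr_right fun _ => ⟨fun h i l => ?_, fun h i n x => ?_⟩
  · have := h i l.length l.get
    rwa [← cyl_ofFn, wordProb_eq_listProb, List.ofFn_get] at this
  · rw [← cyl_ofFn, wordProb_eq_listProb, h]

variable [DiscreteMeasurableSpace V]

/-- The free positions are filled one at a time, each letter being adjoined to the left word, until
the event is a single cylinder. -/
lemma measureReal_cyl_inter_cyl {G : SimpleGraph V} {μ : Measure (ℤ → V)} [IsProbabilityMeasure μ]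
    (h : ∀ i l, μ.real (cyl i l) = listProb G l) (i : ℤ) (k : ℕ) (x y : List V) :
    μ.real (cyl i x ∩ cyl (i + x.length + k) y) =
      gapSum G k x y / totalCount G (x.length + k + y.length) := by
  induction k generalizing x with
  | zero => rw [Nat.cast_zero, add_zero, ← cyl_append, h, listProb]; simp
  | succ k ih =>
    rw [measureReal_eq_sum_coord μ _ (i + x.length + 1), gapSum_succ, Finset.sum_div]
    refine Finset.sum_congr rfl fun v _ => ?_
    have := ih (x ++ [v])
    rw [cyl_append_singleton, List.length_append, List.length_singleton] at this
    rw [Set.inter_right_comm]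
    convert this using 4
    · push_cast; ring
    · omega

/-- A balanced complete multipartite graph whose gap sums factorize has a consistent insertion
algorithm and a finitely dependent insertion process. -/
lemma exists_insertionLaw_of_gapSum {ι : Type*} [DecidableEq ι] {G : SimpleGraph V} {c : V → ι}
    (hc : ∀ a b, G.Adj a b ↔ c a ≠ c b) {m r : ℝ}
    (hr : ∀ a, ((Finset.univ.filter fun b => c b = c a).card : ℝ) = r)
    (hm : (Fintype.card V : ℝ) = m * r) (hr0 : 0 < r) (hm2 : 2 < m) {k : ℕ}
    (hK : ∃ K : ℕ → ℕ → ℝ, ∀ x y : List V,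
      gapSum G k x y = K x.length y.length * (listCount G x * listCount G y)) :
    IsConsistent G ∧ ∃ μ : Measure (ℤ → V), IsInsertionLaw G μ ∧ IsStationary μ ∧
      IsKDependent k μ := by
  obtain ⟨K, hK⟩ := hK
  let C : ℕ → ℝ := fun n => (m + n * (m - 2)) * r
  have hC : ∀ n, 0 < C n := fun n => by
    have : (0 : ℝ) ≤ n * (m - 2) := mul_nonneg n.cast_nonneg (by linarith)
    exact mul_pos (by linarith) hr0
  have hsucc : ∀ n, totalCount G (n + 1) = C n * totalCount G n := fun n => by
    rw [totalCount_eq_wordSum, totalCount_eq_wordSum, wordSum_succ', ← wordSum_sum, ← wordSum_mul]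
    refine wordSum_congr_length fun u hu => ?_
    rw [sum_listCount_append_singleton hc hr hm, hu]
  have hZ : ∀ n, 0 < totalCount G n := fun n => by
    induction n with
    | zero => simp [totalCount_eq_wordSum]
    | succ n ih => rw [hsucc]; exact mul_pos (hC n) ih
  have hsnoc : ∀ l, listProb G l = ∑ v, listProb G (l ++ [v]) := fun l => by
    simp only [listProb, ← Finset.sum_div, List.length_append, List.length_singleton, hsucc,
      sum_listCount_append_singleton hc hr hm]
    exact (mul_div_mul_left _ _ (hC l.length).ne').symm
  have hcons : ∀ l, listProb G l = ∑ v, listProb G (v :: l) := fun l => by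
    simp only [listProb, ← Finset.sum_div, List.length_cons, hsucc,
      sum_listCount_cons hc hr hm]
    exact (mul_div_mul_left _ _ (hC l.length).ne').symm
  have h0 : listProb G [] = 1 := by simp [listProb, totalCount_eq_wordSum]
  have hnn : ∀ l, 0 ≤ listProb G l := fun l => div_nonneg (listCount_nonneg G l) (hZ _).le
  refine ⟨(isConsistent_iff G).2 ⟨hZ, fun l => ⟨hsnoc l, hcons l⟩⟩, ?_⟩
  obtain ⟨μ, hμ, hμp⟩ := exists_measure_cyl h0 hnn hsnoc hcons
  refine ⟨μ, (isInsertionLaw_iff G μ).2 ⟨hμ, hμp⟩, isStationary_of_cyl hμp,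
    isKDependent_of_cyl fun x y => ?_⟩
  have hreal : ∀ i l, μ.real (cyl i l) = listProb G l := fun i l => by
    rw [measureReal_def, hμp, ENNReal.toReal_ofReal (hnn l)]
  -- Summing the factorization over all words of the two lengths identifies `K` with the ratio of
  -- normalizing totals that independence requires.
  have hKZ : totalCount G (x.length + k + y.length) =
      K x.length y.length * (totalCount G x.length * totalCount G y.length) := by
    rw [← wordSum_gapSum, wordSum_congr_length (g := fun u =>
      K x.length y.length * totalCount G y.length * listCount G u), wordSum_mul,
      ← totalCount_eq_wordSum]
    · ring
    · intro u hu
      rw [wordSum_congr_length (g := fun v => K x.length y.length * listCount G u * listCount G v),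
        wordSum_mul, ← totalCount_eq_wordSum]
      · ring
      · intro v hv
        rw [hK, hu, hv]; ring
  have hgap := measureReal_cyl_inter_cyl hreal (-1 - x.length) k x y
  have e : (-1 - x.length + x.length + k : ℤ) = k - 1 := by ring
  rw [e, hK, hKZ] at hgap
  have hx := (hZ x.length).ne'
  have hy := (hZ y.length).ne'
  have hK0 : K x.length y.length ≠ 0 := by
    intro h
    rw [h, zero_mul] at hKZ
    exact (hZ _).ne' hKZ
  rw [← ENNReal.toReal_eq_toReal_iff' (measure_ne_top _ _)
    (ENNReal.mul_ne_top (measure_ne_top _ _) (measure_ne_top _ _)), ENNReal.toReal_mul]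
  simp only [← measureReal_def, hreal, hgap]
  rw [listProb, listProb]
  field_simp

end InsertionProcess

end

/-! ### Necessity: the spectrum of the adjacency matrix -/

noncomputable section

namespace InsertionProcess

variable {V : Type*} {G : SimpleGraph V}

open Classical in
/-- The indicator of the paths among the words. -/
def pathIndicator (G : SimpleGraph V) (l : List V) : ℝ := if l.IsChain G.Adj then 1 else 0

lemma listCount_eq_pathIndicator_mul {l : List V} (h0 : l ≠ []) :
    listCount G l = pathIndicator G l * delSum (listCount G) l := by
  by_cases h : l.IsChain G.Adj
  · simp [pathIndicator, h, ← listCount_eq_delSum G h h0]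
  · simp [pathIndicator, h, listCount_eq_zero G h]

lemma unitWeight_comm (G : SimpleGraph V) (a b : V) : unitWeight G a b = unitWeight G b a := by
  by_cases h : G.Adj a b
  · simp [unitWeight, h, h.symm]
  · have h' : ¬ G.Adj b a := fun h' => h h'.symm
    simp [unitWeight, h, h']

lemma pathIndicator_cons_mul (a c : V) (z : List V) :
    pathIndicator G (a :: c :: z) * listCount G (c :: z) =
      unitWeight G a c * listCount G (c :: z) := by
  by_cases h : (c :: z).IsChain G.Adj
  · by_cases hac : G.Adj a c <;> simp [pathIndicator, unitWeight, h, hac]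
  · simp [listCount_eq_zero G h]

lemma pathIndicator_append_mul (x : List V) (c b : V) :
    pathIndicator G (x ++ [c, b]) * listCount G (x ++ [c]) =
      listCount G (x ++ [c]) * unitWeight G c b := by
  by_cases h : (x ++ [c]).IsChain G.Adj
  · by_cases hcb : G.Adj c b <;>
      simp [pathIndicator, unitWeight, List.isChain_append_cons_cons, h, hcb]
  · simp [listCount_eq_zero G h]

variable [Fintype V]

/-- A symbol can be put back between adjacent `p` and `q` in `lam` ways; if they are not adjacent,
the remaining count is already zero. -/
lemma sum_pathIndicator_mul {lam : ℝ}
    (hlam : ∀ a b, G.Adj a b → ∑ c, unitWeight G a c * unitWeight G c b = lam)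
    (x z : List V) (p q : V) :
    ∑ a, pathIndicator G (x ++ p :: a :: q :: z) * listCount G (x ++ p :: q :: z) =
      lam * listCount G (x ++ p :: q :: z) := by
  by_cases h : (x ++ p :: q :: z).IsChain G.Adj
  · obtain ⟨h1, h2, h3⟩ := List.isChain_append_cons_cons.1 h
    rw [← Finset.sum_mul, ← hlam p q h2]
    congr 1
    refine Finset.sum_congr rfl fun a _ => ?_
    by_cases hpa : G.Adj p a <;> by_cases haq : G.Adj a q <;>
      simp [pathIndicator, unitWeight, List.isChain_append_cons_cons, h1, h3, hpa, haq]
  · simp [listCount_eq_zero G h]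

/-- Each of the `n` gap positions can hold the last insertion and contributes `lam` times the
shorter gap sum. The truncated `n - 1` is harmless at `n = 0`, where the factor `n` vanishes. -/
lemma wordSum_interior {lam : ℝ}
    (hlam : ∀ a b, G.Adj a b → ∑ c, unitWeight G a c * unitWeight G c b = lam)
    (n : ℕ) (x y : List V) (p s : V) :
    wordSum n (fun u => pathIndicator G (x ++ p :: (u ++ s :: y)) *
        delSum (fun t => listCount G (x ++ p :: (t ++ s :: y))) u) =
      n * lam * gapSum G (n - 1) (x ++ [p]) (s :: y) := by
  induction n generalizing x p with
  | zero => simp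
  | succ n ih =>
    simp only [wordSum_succ, delSum_cons, mul_add, wordSum_add, Finset.sum_add_distrib]
    have h1 : ∑ a, wordSum n (fun u => pathIndicator G (x ++ p :: (a :: u ++ s :: y)) *
        listCount G (x ++ p :: (u ++ s :: y))) = lam * gapSum G n (x ++ [p]) (s :: y) := by
      rw [← wordSum_sum, gapSum, ← wordSum_mul]
      refine wordSum_congr fun u => ?_
      obtain ⟨q, z, hq⟩ : ∃ q z, u ++ s :: y = q :: z := List.exists_cons_of_ne_nil (by simp)
      simpa [hq] using sum_pathIndicator_mul hlam x z p q
    have h2 : ∑ a, wordSum n (fun u => pathIndicator G (x ++ p :: (a :: u ++ s :: y)) *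
        delSum (fun t => listCount G (x ++ p :: (a :: t ++ s :: y))) u) =
        n * lam * gapSum G n (x ++ [p]) (s :: y) := by
      have := fun a => ih (x ++ [p]) a
      simp only [List.append_assoc, List.cons_append, List.nil_append] at this
      simp only [List.cons_append, this]
      cases n with
      | zero => simp
      | succ n => simp [gapSum_succ G n (x ++ [p]), Finset.mul_sum]
    rw [h1, h2]
    push_cast
    ring

/-- The recursion for the two-point counts, obtained by removing the symbol inserted last. -/
lemma gapSum_succ_singleton {lam : ℝ}
    (hlam : ∀ a b, G.Adj a b → ∑ c, unitWeight G a c * unitWeight G c b = lam)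
    (n : ℕ) (a b : V) :
    gapSum G (n + 1) [a] [b] = (n + 1) * lam * gapSum G n [a] [b] +
      ∑ c, unitWeight G a c * gapSum G n [c] [b] +
      ∑ c, gapSum G n [a] [c] * unitWeight G c b := by
  -- The symbol inserted last lies in the gap, or is the left end, or is the right end.
  have h : ∀ u : List V, listCount G ([a] ++ u ++ [b]) =
      pathIndicator G ([] ++ a :: (u ++ [b])) *
        delSum (fun t => listCount G ([] ++ a :: (t ++ [b]))) u +
      pathIndicator G (a :: (u ++ [b])) * listCount G (u ++ [b]) +
      pathIndicator G (a :: (u ++ [b])) * listCount G (a :: u) := fun u => by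
    rw [listCount_eq_pathIndicator_mul (by simp)]
    simp [delSum_append]
    ring
  have hl : wordSum (n + 1) (fun u => pathIndicator G (a :: (u ++ [b])) * listCount G (u ++ [b])) =
      ∑ c, unitWeight G a c * gapSum G n [c] [b] := by
    rw [wordSum_succ]
    refine Finset.sum_congr rfl fun c _ => ?_
    rw [gapSum, ← wordSum_mul]
    exact wordSum_congr fun u => by simpa using pathIndicator_cons_mul a c (u ++ [b])
  have hr : wordSum (n + 1) (fun u => pathIndicator G (a :: (u ++ [b])) * listCount G (a :: u)) =
      ∑ c, gapSum G n [a] [c] * unitWeight G c b := by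
    rw [wordSum_succ']
    refine Finset.sum_congr rfl fun c _ => ?_
    rw [gapSum, mul_comm, ← wordSum_mul]
    refine wordSum_congr fun u => ?_
    have := pathIndicator_append_mul (G := G) (a :: u) c b
    rw [mul_comm (unitWeight G c b)]
    simpa using this
  rw [gapSum, wordSum_congr h, wordSum_add, wordSum_add, hl, hr, wordSum_interior hlam]
  simp

/-- On an eigenvector of the adjacency matrix, left and right multiplication by that matrix each
contribute `θ`, so the matrix recursion becomes a scalar product. -/
lemma sum_gapSum_mul_eigenvector {lam : ℝ}
    (hlam : ∀ a b, G.Adj a b → ∑ c, unitWeight G a c * unitWeight G c b = lam)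
    {θ : ℝ} {v : V → ℝ} (hv : ∀ a, ∑ b, unitWeight G a b * v b = θ * v a) (n : ℕ) (a : V) :
    ∑ b, gapSum G n [a] [b] * v b = (∏ j ∈ Finset.range (n + 1), (j * lam + 2 * θ)) * v a := by
  induction n generalizing a with
  | zero =>
    simp only [gapSum_zero, List.singleton_append, listCount_pair, mul_assoc, ← Finset.mul_sum, hv]
    simp
    ring
  | succ n ih =>
    have h1 : ∑ b, (∑ c, unitWeight G a c * gapSum G n [c] [b]) * v b =
        θ * ∑ b, gapSum G n [a] [b] * v b := by
      simp only [Finset.sum_mul]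
      rw [Finset.sum_comm]
      simp only [mul_assoc, ← Finset.mul_sum, ih]
      rw [mul_left_comm, ← hv, Finset.mul_sum]
      exact Finset.sum_congr rfl fun c _ => by ring
    have h2 : ∑ b, (∑ c, gapSum G n [a] [c] * unitWeight G c b) * v b =
        θ * ∑ b, gapSum G n [a] [b] * v b := by
      simp only [Finset.sum_mul]
      rw [Finset.sum_comm]
      simp only [mul_assoc, ← Finset.mul_sum, hv]
      rw [Finset.mul_sum]
      exact Finset.sum_congr rfl fun c _ => by ring
    have h3 : ∑ b, gapSum G (n + 1) [a] [b] * v b =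
        ((n + 1) * lam + 2 * θ) * ∑ b, gapSum G n [a] [b] * v b := by
      simp only [gapSum_succ_singleton hlam, add_mul _ _ (v _), Finset.sum_add_distrib, h1, h2,
        mul_assoc _ _ (v _), ← Finset.mul_sum]
      ring
    rw [h3, ih, Finset.prod_range_succ _ (n + 1)]
    push_cast
    ring

/-- If the two-point counts are constant, the eigenvalues of the adjacency matrix on the vectors
of sum zero are nonpositive half-multiples of `lam`. -/
lemma exists_eigenvalue_eq {lam : ℝ}
    (hlam : ∀ a b, G.Adj a b → ∑ c, unitWeight G a c * unitWeight G c b = lam)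
    {k : ℕ} {K : ℝ} (hK : ∀ a b, gapSum G k [a] [b] = K)
    {θ : ℝ} {v : V → ℝ} (hv : ∀ a, ∑ b, unitWeight G a b * v b = θ * v a) (hv0 : v ≠ 0)
    (hsum : ∑ a, v a = 0) : ∃ j : ℕ, j ≤ k ∧ j * lam + 2 * θ = 0 := by
  obtain ⟨a, ha⟩ := Function.ne_iff.1 hv0
  -- A constant matrix kills vectors of sum zero, so some factor of the product vanishes.
  have h := sum_gapSum_mul_eigenvector hlam hv k a
  simp only [hK, ← Finset.mul_sum, hsum, mul_zero] at h
  rcases mul_eq_zero.1 h.symm with h | h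
  · obtain ⟨j, hj, hj'⟩ := Finset.prod_eq_zero_iff.1 h
    exact ⟨j, by simpa [Nat.lt_succ_iff] using hj, hj'⟩
  · exact absurd h ha

/-- With `N` the number of vertices, the matrix `M = (d/N) J - A` kills constants by regularity and
agrees with `-A` on vectors of sum zero. An eigenvector of `M` with negative eigenvalue would have
sum zero and a positive `A`-eigenvalue, against `exists_eigenvalue_eq`. -/
lemma sum_mul_unitWeight_mul_nonpos {d lam : ℝ} (hd : ∀ a, ∑ b, unitWeight G a b = d)
    (hlam : ∀ a b, G.Adj a b → ∑ c, unitWeight G a c * unitWeight G c b = lam) (hlam0 : 0 ≤ lam)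
    {k : ℕ} {K : ℝ} (hK : ∀ a b, gapSum G k [a] [b] = K) {f : V → ℝ} (hf : ∑ a, f a = 0) :
    ∑ a, f a * ∑ b, unitWeight G a b * f b ≤ 0 := by
  classical
  rcases isEmpty_or_nonempty V with hV | hV
  · simp
  have hN : (Fintype.card V : ℝ) ≠ 0 := by simp
  let M : Matrix V V ℝ := fun a b => d / Fintype.card V - unitWeight G a b
  have hM : M.IsHermitian := by
    ext a b
    rw [Matrix.conjTranspose_apply, star_trivial]
    simp only [M, unitWeight_comm G a b]
  have hMv : ∀ (v : V → ℝ) (a : V),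
      M.mulVec v a = d / Fintype.card V * ∑ b, v b - ∑ b, unitWeight G a b * v b := by
    intro v a
    simp [M, Matrix.mulVec, dotProduct, sub_mul, Finset.mul_sum]
  have hpos : M.PosSemidef := by
    rw [hM.posSemidef_iff_eigenvalues_nonneg]
    intro i
    by_contra! hi
    simp only [Pi.zero_apply] at hi
    let v : V → ℝ := ⇑(hM.eigenvectorBasis i)
    have hv : ∀ a, M.mulVec v a = hM.eigenvalues i * v a := fun a => by
      have := congrFun (hM.mulVec_eigenvectorBasis i) a
      simpa using this
    have hv0 : v ≠ 0 := by
      intro h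
      have := hM.eigenvectorBasis.toBasis.ne_zero i
      apply this
      ext a
      simpa using congrFun h a
    have hsum : ∑ a, v a = 0 := by
      have h1 : ∑ a, M.mulVec v a = 0 := by
        simp only [hMv, Finset.sum_sub_distrib]
        rw [Finset.sum_comm]
        simp only [unitWeight_comm G _, ← Finset.sum_mul, hd]
        rw [← Finset.mul_sum]
        simp
        field_simp
        ring
      simp only [hv, ← Finset.mul_sum] at h1
      exact (mul_eq_zero.1 h1).resolve_left hi.ne
    have hA : ∀ a, ∑ b, unitWeight G a b * v b = (-hM.eigenvalues i) * v a := fun a => by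
      have := hMv v a
      rw [hv, hsum] at this
      linarith
    obtain ⟨j, -, hj⟩ := exists_eigenvalue_eq hlam hK hA hv0 hsum
    have : (0 : ℝ) ≤ j * lam := by positivity
    linarith
  have := hpos.dotProduct_mulVec_nonneg f
  simp only [dotProduct, hMv, hf, mul_zero, zero_sub, mul_neg, Finset.sum_neg_distrib,
    Pi.star_apply, star_trivial] at this
  linarith

end InsertionProcess

end

/-! ### Necessity: identifying the graph and its parameters -/

noncomputable section

namespace InsertionProcess

variable {V : Type*} {G : SimpleGraph V}

/-- When `v` is adjacent to `b`, deleting either end leaves an edge, of count two; deleting `b`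
leaves `[a, v]`. The common-neighbour indicator thus appears linearly, ready to be summed over `v`.
-/
lemma listCount_triple {a b : V} (hab : G.Adj a b) (v : V) :
    listCount G [a, b, v] =
      4 * unitWeight G b v + 2 * (unitWeight G a v * unitWeight G v b) := by
  by_cases hbv : G.Adj b v
  · rw [listCount_eq_delSum G (by simp [hab, hbv]) (by simp)]
    simp [listCount_pair, unitWeight, hab, hbv, hbv.symm]
    ring
  · have hvb : ¬ G.Adj v b := fun h => hbv h.symm
    rw [listCount_eq_zero G (by simp [hbv])]
    simp [unitWeight, hbv, hvb]

/-- Complete multipartite graphs with equally many parts of equal sizes are isomorphic. -/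
lemma nonempty_iso_of_parts {ι : Type*} {W : ι → Type*} {m r : ℕ} (e : ι ≃ Fin m)
    (f : ∀ i, W i ≃ Fin r) :
    Nonempty (SimpleGraph.completeMultipartiteGraph W ≃g
      SimpleGraph.completeMultipartiteGraph (fun _ : Fin m => Fin r)) :=
  ⟨{ toEquiv := (Equiv.sigmaCongrRight f).trans
        ((Equiv.sigmaEquivProd ι (Fin r)).trans ((e.prodCongr (Equiv.refl _)).trans
          (Equiv.sigmaEquivProd (Fin m) (Fin r)).symm))
     map_rel_iff' := by
      rintro ⟨i, x⟩ ⟨j, y⟩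
      simp }⟩

variable [Fintype V]

/-- With `Z_n` the totals, consistency at a single letter reads `1 / Z_1 = 2 deg(a) / Z_2`. -/
lemma IsConsistent.exists_degree (h : IsConsistent G) :
    ∃ d : ℝ, ∀ a, ∑ b, unitWeight G a b = d := by
  obtain ⟨hZ, hl⟩ := (isConsistent_iff G).1 h
  refine ⟨totalCount G 2 / totalCount G 1 / 2, fun a => ?_⟩
  have := (hl [a]).1
  have h1 := (hZ 1).ne'
  have h2 := (hZ 2).ne'
  simp only [listProb, List.singleton_append, listCount_pair, listCount_singleton,
    List.length_cons, List.length_nil, ← Finset.sum_div, ← Finset.mul_sum, zero_add,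
    Nat.reduceAdd] at this
  field_simp at this ⊢
  linarith

/-- Consistency at an edge reads `2 / Z_2 = (4 d + 2 lam) / Z_3`. -/
lemma IsConsistent.exists_codegree (h : IsConsistent G) :
    ∃ lam : ℝ, ∀ a b, G.Adj a b → ∑ c, unitWeight G a c * unitWeight G c b = lam := by
  obtain ⟨hZ, hl⟩ := (isConsistent_iff G).1 h
  obtain ⟨d, hd⟩ := h.exists_degree
  refine ⟨totalCount G 3 / totalCount G 2 - 2 * d, fun a b hab => ?_⟩
  have := (hl [a, b]).1
  have h2 := (hZ 2).ne'
  have h3 := (hZ 3).ne'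
  simp only [listProb, List.cons_append, List.nil_append, listCount_pair, listCount_triple hab,
    List.length_cons, List.length_nil, ← Finset.sum_div, ← Finset.mul_sum, zero_add,
    Nat.reduceAdd, Finset.sum_add_distrib, hd] at this
  simp only [unitWeight, hab, if_true] at this ⊢
  field_simp at this ⊢
  linarith

/-- If `a, b` and `b, c` are non-edges but `a, c` is an edge, the vector with values `1, -2, 1` at
`a, b, c` has sum zero and quadratic form `2`. Hence non-adjacency is transitive. -/
lemma isCompleteMultipartite_of_nonpos
    (h : ∀ f : V → ℝ, ∑ a, f a = 0 → ∑ a, f a * ∑ b, unitWeight G a b * f b ≤ 0) :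
    G.IsCompleteMultipartite := by
  classical
  refine ⟨fun a b c hab hbc hac => ?_⟩
  have hba : ¬ G.Adj b a := fun h => hab h.symm
  have hcb : ¬ G.Adj c b := fun h => hbc h.symm
  have := h (fun x => (if x = a then 1 else 0) + -2 * (if x = b then 1 else 0) +
    if x = c then 1 else 0) (by simp [Finset.sum_add_distrib]; norm_num)
  simp [Finset.sum_add_distrib, add_mul, mul_add] at this
  simp [unitWeight, hab, hbc, hba, hcb, hac, hac.symm] at this
  norm_num at this

/-- The part of a vertex is its set of non-neighbours, whose size `|V| - d` is the same for all
vertices. -/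
lemma exists_iso_of_isCompleteMultipartite (h : G.IsCompleteMultipartite) {d : ℝ}
    (hd : ∀ a, ∑ b, unitWeight G a b = d) :
    ∃ m r : ℕ, Nonempty (G ≃g SimpleGraph.completeMultipartiteGraph (fun _ : Fin m => Fin r)) := by
  classical
  let S := h.setoid
  have hcard : ∀ a, (Fintype.card {x // ¬ G.Adj a x} : ℝ) = Fintype.card V - d := fun a => by
    rw [← hd a, Fintype.card_subtype, ← Finset.sum_boole, eq_sub_iff_add_eq,
      ← Finset.sum_add_distrib]
    have : ∀ x, ((if ¬ G.Adj a x then 1 else 0) + unitWeight G a x : ℝ) = 1 := fun x => by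
      by_cases hx : G.Adj a x <;> simp [unitWeight, hx]
    simp only [this]
    simp
  obtain ⟨r, hr⟩ : ∃ r : ℕ, ∀ a, Fintype.card {x // ¬ G.Adj a x} = r := by
    rcases isEmpty_or_nonempty V with hV | ⟨⟨a₀⟩⟩
    · exact ⟨0, fun a => hV.elim a⟩
    · exact ⟨_, fun a => by exact_mod_cast (hcard a).trans (hcard a₀).symm⟩
  obtain ⟨e⟩ := nonempty_iso_of_parts (Fintype.equivFin (Quotient S))
    (fun q => Fintype.equivFinOfCardEq (hr q.out))
  exact ⟨_, r, ⟨h.iso.trans e⟩⟩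

/-- The parameters for which constant two-point counts are possible. -/
lemma parameters_of_gapSum_const {m r k : ℕ}
    (e : G ≃g SimpleGraph.completeMultipartiteGraph (fun _ : Fin m => Fin r)) {a b : V}
    (hab : G.Adj a b) {lam : ℝ}
    (hlam : ∀ a b, G.Adj a b → ∑ c, unitWeight G a c * unitWeight G c b = lam)
    {K : ℝ} (hK : ∀ a b, gapSum G k [a] [b] = K) :
    1 ≤ r ∧ ((m = 3 ∧ 2 ≤ k) ∨ (m = 4 ∧ 1 ≤ k)) := by
  obtain ⟨hc, hr, hm⟩ := card_color_of_iso e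
  set c : V → Fin m := fun v => (e v).1 with hcdef
  change ∀ a b, G.Adj a b ↔ c a ≠ c b at hc
  change ∀ a, (Finset.univ.filter fun b => c b = c a).card = r at hr
  have hr1 : 1 ≤ r := by
    rw [← hr a]
    exact Finset.card_pos.2 ⟨a, by simp⟩
  have hca : c a ≠ c b := (hc a b).1 hab
  have hw : ∀ x y, unitWeight G x y = 1 - if c y = c x then 1 else 0 := fun x y => by
    by_cases h : c y = c x
    · have : ¬ G.Adj x y := by rw [hc]; simpa using h.symm
      simp [unitWeight, h, this]
    · have : G.Adj x y := (hc x y).2 (Ne.symm h)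
      simp [unitWeight, h, this]
  have hsum : ∀ p, ∑ y, (if c y = c p then (1 : ℝ) else 0) = r := fun p => by
    rw [Finset.sum_boole, hr]
  have hlam' : lam = (m - 2) * r := by
    rw [← hlam a b hab]
    have : ∀ y, unitWeight G a y * unitWeight G y b =
        1 - ((if c y = c a then 1 else 0) + if c y = c b then 1 else 0) := fun y => by
      rw [unitWeight_comm G y b, hw, hw]
      by_cases h1 : c y = c a
      · simp [h1, hca]
      · simp [h1]
    simp only [this, Finset.sum_sub_distrib, Finset.sum_add_distrib, hsum]
    simp [hm]
    ring
  -- The difference of the indicators of two parts has sum zero and is an eigenvector with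
  -- eigenvalue `-r`.
  let f : V → ℝ := fun x => (if c x = c a then 1 else 0) - if c x = c b then 1 else 0
  have hpart : ∀ x p, ∑ y, unitWeight G x y * (if c y = c p then (1 : ℝ) else 0) =
      r - r * if c x = c p then 1 else 0 := fun x p => by
    by_cases h : c x = c p
    · have : ∀ y, unitWeight G x y * (if c y = c p then (1 : ℝ) else 0) = 0 := fun y => by
        rw [hw, h]
        by_cases h' : c y = c p <;> simp [h']
      simp [this, h]
    · have : ∀ y, unitWeight G x y * (if c y = c p then (1 : ℝ) else 0) =
          if c y = c p then (1 : ℝ) else 0 := fun y => by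
        rw [hw]
        by_cases h' : c y = c p
        · simp [h', Ne.symm h]
        · simp [h']
      simp only [this, hsum, h, if_false, mul_zero, sub_zero]
  have hf : ∀ x, ∑ y, unitWeight G x y * f y = (-r : ℝ) * f x := fun x => by
    simp only [f, mul_sub, Finset.sum_sub_distrib, hpart]
    ring
  have hf0 : f ≠ 0 := fun h => by
    have := congrFun h a
    simp [f, hca] at this
  have hfs : ∑ x, f x = 0 := by
    simp only [f, Finset.sum_sub_distrib, hsum, sub_self]
  obtain ⟨j, hjk, hj⟩ := exists_eigenvalue_eq hlam hK hf hf0 hfs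
  refine ⟨hr1, ?_⟩
  have hr0 : (r : ℝ) ≠ 0 := by positivity
  have hj' : (j : ℝ) * (m - 2) = 2 := by
    rw [hlam'] at hj
    refine mul_right_cancel₀ hr0 ?_
    linarith
  -- Over the integers, `j` divides `2`: `j = 1` gives `m = 4`, `j = 2` gives `m = 3`, and `j ≤ k`
  -- bounds `k`.
  have hjZ : (j : ℤ) * ((m : ℤ) - 2) = 2 := by exact_mod_cast hj'
  have hj2 : j ≤ 2 := by
    have : (j : ℤ) ∣ 2 := ⟨_, hjZ.symm⟩
    exact_mod_cast Int.le_of_dvd (by norm_num) this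
  interval_cases j <;> omega

variable [MeasurableSpace V] [DiscreteMeasurableSpace V]

/-- Single letters are uniform, so independence of the coordinates at `-1` and `k` gives every pair
of letters the same probability. -/
lemma gapSum_const_of_isKDependent {k : ℕ} {μ : Measure (ℤ → V)} (hG : IsConsistent G)
    (hμ : IsInsertionLaw G μ) (hk : IsKDependent k μ) :
    ∃ K : ℝ, ∀ a b, gapSum G k [a] [b] = K := by
  obtain ⟨hprob, hcyl⟩ := (isInsertionLaw_iff G μ).1 hμ
  have hreal : ∀ i l, μ.real (cyl i l) = listProb G l := fun i l => by
    rw [measureReal_def, hcyl]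
    exact ENNReal.toReal_ofReal (div_nonneg (listCount_nonneg G l) (hG.1 _).le)
  refine ⟨totalCount G (k + 2) / (totalCount G 1 * totalCount G 1), fun a b => ?_⟩
  have hgap := measureReal_cyl_inter_cyl hreal (-2) k [a] [b]
  have hindep := hk.measure_inter_preimage_eq_mul
    ((fun z : {i : ℤ // i < 0} → V => z ⟨-1, by norm_num⟩) ⁻¹' {a})
    ((fun z : {i : ℤ // (k : ℤ) ≤ i} → V => z ⟨k, le_rfl⟩) ⁻¹' {b})
    (measurable_pi_apply _ MeasurableSet.of_discrete)
    (measurable_pi_apply _ MeasurableSet.of_discrete)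
  have ea : cyl (-2) [a] = (fun (ω : ℤ → V) (i : {i : ℤ // i < 0}) => ω i) ⁻¹'
      ((fun z : {i : ℤ // i < 0} → V => z ⟨-1, by norm_num⟩) ⁻¹' {a}) := by
    rw [cyl_cons, cyl_nil, Set.inter_univ]; rfl
  have eb : cyl (k - 1) [b] = (fun (ω : ℤ → V) (i : {i : ℤ // (k : ℤ) ≤ i}) => ω i) ⁻¹'
      ((fun z : {i : ℤ // (k : ℤ) ≤ i} → V => z ⟨k, le_rfl⟩) ⁻¹' {b}) := by
    rw [cyl_cons, cyl_nil, Set.inter_univ, sub_add_cancel]; rfl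
  rw [← ea, ← eb] at hindep
  have e : (-2 + (([a] : List V).length : ℤ) + k) = k - 1 := by simp; ring
  rw [e, measureReal_def, hindep, ENNReal.toReal_mul, ← measureReal_def, ← measureReal_def,
    hreal, hreal] at hgap
  have h1 := (hG.1 1).ne'
  have h2 := (hG.1 (k + 2)).ne'
  have e2 : ([a] : List V).length + k + ([b] : List V).length = k + 2 := by simp; omega
  rw [e2] at hgap
  simp only [listProb, listCount_singleton, List.length_singleton] at hgap
  rw [eq_div_iff h2] at hgap
  rw [← hgap]
  field_simp

end InsertionProcess

end

open InsertionProcess in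
theorem theorem1 {V : Type*} [Fintype V] [MeasurableSpace V] [DiscreteMeasurableSpace V]
    (G : SimpleGraph V) (k : ℕ) :
    (InsertionProcess.IsConsistent G ∧
      ∃ μ : MeasureTheory.Measure (ℤ → V), InsertionProcess.IsInsertionLaw G μ ∧
        InsertionProcess.IsStationary μ ∧ InsertionProcess.IsKDependent k μ) ↔
    ((∃ r : ℕ, 1 ≤ r ∧
        Nonempty (G ≃g SimpleGraph.completeMultipartiteGraph (fun _ : Fin 3 => Fin r))) ∧
      2 ≤ k) ∨
    ((∃ r : ℕ, 1 ≤ r ∧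
        Nonempty (G ≃g SimpleGraph.completeMultipartiteGraph (fun _ : Fin 4 => Fin r))) ∧
      1 ≤ k) := by
  constructor
  · rintro ⟨hG, μ, hμ, -, hk⟩
    obtain ⟨d, hd⟩ := hG.exists_degree
    obtain ⟨lam, hlam⟩ := hG.exists_codegree
    obtain ⟨K, hK⟩ := gapSum_const_of_isKDependent hG hμ hk
    -- Without edges the total over words of length two would vanish.
    obtain ⟨a, b, hab⟩ : ∃ a b, G.Adj a b := by
      by_contra! h
      have := hG.1 2
      simp [totalCount_eq_wordSum, wordSum_succ, listCount_pair, unitWeight, h] at this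
    have hlam0 : 0 ≤ lam := by
      rw [← hlam a b hab]
      refine Finset.sum_nonneg fun c _ => mul_nonneg ?_ ?_ <;>
        (unfold unitWeight; split_ifs <;> norm_num)
    have hmp := isCompleteMultipartite_of_nonpos fun f hf =>
      sum_mul_unitWeight_mul_nonpos hd hlam hlam0 hK hf
    obtain ⟨m, r, ⟨e⟩⟩ := exists_iso_of_isCompleteMultipartite hmp hd
    obtain ⟨hr, ⟨rfl, h2⟩ | ⟨rfl, h1⟩⟩ := parameters_of_gapSum_const e hab hlam hK
    · exact Or.inl ⟨⟨r, hr, ⟨e⟩⟩, h2⟩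
    · exact Or.inr ⟨⟨r, hr, ⟨e⟩⟩, h1⟩
  · rintro (⟨⟨r, hr, ⟨e⟩⟩, hk⟩ | ⟨⟨r, hr, ⟨e⟩⟩, hk⟩)
    · obtain ⟨hc, hcard, hV⟩ := card_color_of_iso e
      have hcard' : ∀ a, ((Finset.univ.filter fun b => (e b).1 = (e a).1).card : ℝ) = r :=
        fun a => by rw [hcard]
      have hV' : (Fintype.card V : ℝ) = 3 * r := by rw [hV]; push_cast; ring
      obtain ⟨hG, μ, h1, h2, h3⟩ := exists_insertionLaw_of_gapSum hc hcard' hV'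
        (by exact_mod_cast hr) (by norm_num) (exists_gapSum_two_eq_mul hc hcard' hV' rfl)
      exact ⟨hG, μ, h1, h2, h3.mono hk⟩
    · obtain ⟨hc, hcard, hV⟩ := card_color_of_iso e
      have hcard' : ∀ a, ((Finset.univ.filter fun b => (e b).1 = (e a).1).card : ℝ) = r :=
        fun a => by rw [hcard]
      have hV' : (Fintype.card V : ℝ) = 4 * r := by rw [hV]; push_cast; ring
      obtain ⟨hG, μ, h1, h2, h3⟩ := exists_insertionLaw_of_gapSum hc hcard' hV'
        (by exact_mod_cast hr) (by norm_num) (exists_gapSum_one_eq_mul hc hcard' hV' rfl)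
      exact ⟨hG, μ, h1, h2, h3.mono hk⟩
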